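/- A homogeneous polynomial $f\in\mathbb R[x_1,\dots,x_n]$ is hyperbolic with respect to $e\in\mathbb R^n$ if $f(e)\neq 0$ and, for every $a\in\mathbb R^n$, all complex roots of $f(te+a)\in\mathbb R[t]$ are real. Its hyperbolicity cone $C(f,e)$ is the connected component of $e$ in $\mathbb R^n\setminus\mathcal V_{\mathbb R}(f)$, where $\mathcal V_{\mathbb R}(f)=\{x\in\mathbb R^n: f(x)=0\}$. Write $D_ef=\sum_{i=1}^n e_i\,\partial f/\partial x_i$. If $p,q\in\mathbb R[t]$ have only real roots $\alpha_1\le\dots\le\alpha_m$ and $\beta_1\le\dots\le\beta_{m-1}$ respectively (listed with multiplicity, $m=\deg p=\deg q+1$), then $q$ interlaces $p$ if $\alpha_i\le\beta_i\le\alpha_{i+1}$ for all $i=1,\dots,m-1$. If $f$ is hyperbolic with respect to $e$, let $\mathrm{Int}(f,e)$ denote the set of homogeneous real polynomials $g$ of degree $\deg(f)-1$ with $g(e)>0$ such that $g(te+a)$ interlaces $f(te+a)$ for every $a\in\mathbb R^n$. **Theorem 2.1.** Let $d\ge 1$, let $f\in\mathbb R[x_1,\dots,x_n]$ be square-free, homogeneous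 of degree $d$ and hyperbolic with respect to $e\in\mathbb R^n$, with $f(e)>0$, and let $h\in\mathbb R[x_1,\dots,x_n]$ be a nonzero homogeneous polynomial of degree $d-1$. The following are equivalent: 1. $h\in\mathrm{Int}(f,e)$; 2. $f$ is hyperbolic with respect to $a$ and $h\in\mathrm{Int}(f,a)$, for every $a\in C(f,e)$; 3. $D_ef\cdot h\ge 0$ on $\mathcal V_{\mathbb R}(f)$; 4. $D_ef\cdot h-f\cdot D_eh\ge 0$ on all of $\mathbb R^n$. -/

import Mathlib

namespace HyperbolicInterlacers

open MvPolynomial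

/-- All complex zeros of the real univariate polynomial `p` are real.
(The zero polynomial is not real-rooted.) -/
def RealRooted (p : Polynomial ℝ) : Prop :=
  ∀ z : ℂ, Polynomial.aeval z p = 0 → z.im = 0

/-- `g` interlaces `f`, for univariate polynomials: both have only real zeros,
`deg g = deg f - 1`, and the ordered zeros, listed with multiplicity, satisfy
`α₀ ≤ β₀ ≤ α₁ ≤ β₁ ≤ ⋯ ≤ α_k`. -/
def UnivInterlaces (g f : Polynomial ℝ) : Prop :=
  RealRooted f ∧ RealRooted g ∧
    ∃ (k : ℕ) (α : Fin (k + 1) → ℝ) (β : Fin k → ℝ),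
      f.natDegree = k + 1 ∧ g.natDegree = k ∧
      Monotone α ∧ f.roots = Multiset.map α Finset.univ.val ∧
      Monotone β ∧ g.roots = Multiset.map β Finset.univ.val ∧
      ∀ i : Fin k, α i.castSucc ≤ β i ∧ β i ≤ α i.succ

/-- The univariate polynomial `f(t e + a)` in the variable `t`. -/
noncomputable def lineRestrict {n : ℕ} (f : MvPolynomial (Fin n) ℝ) (e a : Fin n → ℝ) :
    Polynomial ℝ :=
  aeval (fun i => Polynomial.X * Polynomial.C (e i) + Polynomial.C (a i)) f

/-- The directional derivative `D_e f = ∑ i, e i * ∂f/∂x_i`. -/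
noncomputable def dirDeriv {n : ℕ} (e : Fin n → ℝ) (f : MvPolynomial (Fin n) ℝ) :
    MvPolynomial (Fin n) ℝ :=
  ∑ i, C (e i) * pderiv i f

/-- `f` is a homogeneous polynomial, hyperbolic with respect to `e`. -/
def IsHyperbolic {n : ℕ} (f : MvPolynomial (Fin n) ℝ) (e : Fin n → ℝ) : Prop :=
  f.IsHomogeneous f.totalDegree ∧ eval e f ≠ 0 ∧
    ∀ a : Fin n → ℝ, RealRooted (lineRestrict f e a)

/-- The hyperbolicity cone `C(f, e)`: the connected component of `e` in the complement
of the real zero set of `f`. -/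
def hyperbolicityCone {n : ℕ} (f : MvPolynomial (Fin n) ℝ) (e : Fin n → ℝ) :
    Set (Fin n → ℝ) :=
  connectedComponentIn {x | eval x f ≠ 0} e

/-- `g` interlaces `f` with respect to `e`: `f` is hyperbolic with respect to `e`, `g` is
homogeneous of degree `deg f - 1`, and `g(t e + a)` interlaces `f(t e + a)` for all `a`. -/
def Interlaces {n : ℕ} (g f : MvPolynomial (Fin n) ℝ) (e : Fin n → ℝ) : Prop :=
  IsHyperbolic f e ∧ (∃ k : ℕ, k + 1 = f.totalDegree ∧ g.IsHomogeneous k) ∧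
    ∀ a : Fin n → ℝ, UnivInterlaces (lineRestrict g e a) (lineRestrict f e a)

/-- `Int(f, e)`: the polynomials that interlace `f` with respect to `e` and are positive
at `e`. -/
def interlacerSet {n : ℕ} (f : MvPolynomial (Fin n) ℝ) (e : Fin n → ℝ) :
    Set (MvPolynomial (Fin n) ℝ) :=
  {g | Interlaces g f e ∧ 0 < eval e g}

end HyperbolicInterlacers

namespace HyperbolicInterlacers

/-! ### Interlacing of real-rooted univariate polynomials, and location of complex roots. -/

section Univariate

open Polynomial Lagrange

/-! Restricted to a line in direction `e`, the quantity `D_e f * h - f * D_e h` is the Wronskian `p'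
q - p q'` of the restrictions `p` of `f` and `q` of `h`. For interlacing polynomials with
nonnegative leading coefficients it is nonnegative (`Nested.wronskian_nonneg`), which gives 1 → 4;
on the zero set of `f` only its first term survives, which gives 4 → 3.

The substance is 3 → 2. Three facts move the hypothesis from `e` to a direction `a` of the cone: `f`
is hyperbolic with respect to `a` (`StableAt.of_mem_hyperbolicityCone`); at a real zero of `f`,
either the whole gradient vanishes or no derivative in a direction of the cone does
(`StableAt.eval_dirDeriv_eq_zero`); hence, the cone being connected, `D_a f` and `D_e f` have the
same sign there (`StableAt.derivative_mul_nonneg`).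

With the sign condition in direction `a`, interlacing is proved on generic lines and extended by a
limit. Square-freeness makes the zeros of `f` simple on a generic line (`exists_ne_zero_isCoprime`).
There `h + ε D_a f` satisfies the sign condition strictly, so it alternates in sign at consecutive
zeros of `f` and has a zero in each gap. Let `ε → 0` and let the generic lines tend to a given one;
the degree does not drop because `h(a) > 0`, which follows from Lagrange interpolation
(`eval_direction_pos`). -/

theorem RealRooted.splits {p : ℝ[X]} (hp : RealRooted p) : p.Splits := by
  refine Splits.of_splits_map (algebraMap ℝ ℂ) (IsAlgClosed.splits _) fun z hz => ?_
  have h0 : aeval z p = 0 := by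
    rw [mem_roots', IsRoot, eval_map_algebraMap] at hz
    exact hz.2
  exact ⟨z.re, by simpa using Complex.ext (by simp) (by simp [hp z h0])⟩

theorem natDegree_C_mul_nodal {k : ℕ} {a : ℝ} (ha : a ≠ 0) (α : Fin k → ℝ) :
    (C a * nodal Finset.univ α).natDegree = k := by
  rw [natDegree_C_mul ha, natDegree_nodal, Finset.card_univ, Fintype.card_fin]

theorem roots_C_mul_nodal {k : ℕ} {a : ℝ} (ha : a ≠ 0) (α : Fin k → ℝ) :
    (C a * nodal Finset.univ α).roots = Multiset.map α Finset.univ.val := by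
  rw [roots_C_mul _ ha, nodal_eq, Finset.prod_eq_multiset_prod]
  exact (congrArg (fun s => (Multiset.prod s).roots)
    (Multiset.map_map (fun x => X - C x) α _).symm).trans (roots_multiset_prod_X_sub_C _)

theorem realRooted_C_mul_nodal {k : ℕ} {a : ℝ} (ha : a ≠ 0) (α : Fin k → ℝ) :
    RealRooted (C a * nodal Finset.univ α) := by
  intro z hz
  simp only [nodal_eq, map_mul, aeval_C, map_prod, map_sub, aeval_X, mul_eq_zero,
    Finset.prod_eq_zero_iff, Finset.mem_univ, true_and] at hz
  rcases hz with hz | ⟨i, hi⟩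
  · exact absurd (by simpa using hz) ha
  · rw [sub_eq_zero] at hi
    simp [hi]

/-- Two nested families of ordered points, `α₀ ≤ β₀ ≤ α₁ ≤ ⋯ ≤ α_k`. -/
def Nested {k : ℕ} (α : Fin (k + 1) → ℝ) (β : Fin k → ℝ) : Prop :=
  Monotone α ∧ Monotone β ∧ ∀ i : Fin k, α i.castSucc ≤ β i ∧ β i ≤ α i.succ

theorem Nested.univInterlaces {k : ℕ} {α : Fin (k + 1) → ℝ} {β : Fin k → ℝ} (hn : Nested α β)
    {a b : ℝ} (ha : a ≠ 0) (hb : b ≠ 0) :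
    UnivInterlaces (C b * nodal Finset.univ β) (C a * nodal Finset.univ α) :=
  ⟨realRooted_C_mul_nodal ha α, realRooted_C_mul_nodal hb β, k, α, β,
    natDegree_C_mul_nodal ha α, natDegree_C_mul_nodal hb β, hn.1, roots_C_mul_nodal ha α, hn.2.1,
    roots_C_mul_nodal hb β, hn.2.2⟩

theorem eq_C_mul_nodal_of_roots {k : ℕ} {p : ℝ[X]} {α : Fin k → ℝ} (hk : p.natDegree = k)
    (hr : p.roots = Multiset.map α Finset.univ.val) :
    p = C p.leadingCoeff * nodal Finset.univ α := by
  have h := C_leadingCoeff_mul_prod_multiset_X_sub_C (p := p) (by rw [hr, hk]; simp)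
  rw [hr, Multiset.map_map] at h
  exact h.symm

theorem UnivInterlaces.exists_nested {p q : ℝ[X]} (h : UnivInterlaces q p) :
    ∃ (k : ℕ) (α : Fin (k + 1) → ℝ) (β : Fin k → ℝ), Nested α β ∧
      p = C p.leadingCoeff * nodal Finset.univ α ∧ q = C q.leadingCoeff * nodal Finset.univ β := by
  obtain ⟨-, -, k, α, β, hp, hq, hα, hpα, hβ, hqβ, hi⟩ := h
  exact ⟨k, α, β, ⟨hα, hβ, hi⟩, eq_C_mul_nodal_of_roots hp hpα, eq_C_mul_nodal_of_roots hq hqβ⟩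

/-- A point outside a nested pair of families either has the same number of points of both
families above it, or the same number below it. -/
theorem Nested.position {k : ℕ} {α : Fin (k + 1) → ℝ} {β : Fin k → ℝ} (hn : Nested α β) {t : ℝ}
    (hα : ∀ i, t ≠ α i) :
    (α 0 < t ∧ ∀ i, β i < t ↔ α i.succ < t) ∨
      (t < α (Fin.last k) ∧ ∀ i, α i.castSucc < t ↔ β i < t) := by
  obtain ⟨hmα, hmβ, hi⟩ := hn
  by_cases hc : ∀ i : Fin k, α i.castSucc < t ↔ β i < t
  · rcases lt_or_gt_of_ne (hα (Fin.last k)) with hl | hl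
    · exact Or.inr ⟨hl, hc⟩
    · have hall : ∀ i, α i < t := fun i => (hmα (Fin.le_last i)).trans_lt hl
      exact Or.inl ⟨hall 0, fun i =>
        ⟨fun _ => hall _, fun h => (hi i).2.trans_lt h⟩⟩
  · push Not at hc
    obtain ⟨i, hc⟩ := hc
    -- If this pairing fails at `i`, then `t` lies in the gap `(α i.castSucc, β i]`, and pairing
    -- each `β` with the next `α` works instead.
    have hi1 : α i.castSucc < t ∧ t ≤ β i := by
      rcases hc with hc | hc
      · exact hc
      · exact absurd ((hi i).1.trans_lt hc.2) (not_lt.2 hc.1)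
    refine Or.inl ⟨(hmα (Fin.zero_le _)).trans_lt hi1.1, fun j =>
      ⟨fun hj => ?_, fun h => (hi j).2.trans_lt h⟩⟩
    have hji : j < i := by
      by_contra hcon
      exact absurd (hi1.2.trans (hmβ (not_lt.1 hcon))) (not_le.2 hj)
    refine (hmα ?_).trans_lt hi1.1
    rw [Fin.le_def]
    simpa [Nat.succ_le_iff] using hji

theorem one_div_sub_le_of_same_side {x y t : ℝ} (hxy : x ≤ y) (hx : t ≠ x)
    (h : x < t ↔ y < t) : 1 / (t - x) ≤ 1 / (t - y) := by
  rcases lt_or_gt_of_ne hx with h1 | h1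
  · have h2 : t < y := h1.trans_le hxy
    exact one_div_le_one_div_of_neg_of_le (by linarith) (by linarith)
  · have h2 := h.1 h1
    exact one_div_le_one_div_of_le (by linarith) (by linarith)

theorem mul_pos_of_same_side {x y t : ℝ} (hx : t ≠ x) (hy : t ≠ y)
    (h : x < t ↔ y < t) : 0 < (t - x) * (t - y) := by
  rcases lt_or_gt_of_ne hx with h1 | h1
  · have h2 : t < y := lt_of_le_of_ne (not_lt.1 fun hc => absurd (h.2 hc) (not_lt.2 h1.le)) hy
    exact mul_pos_of_neg_of_neg (by linarith) (by linarith)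
  · have h2 := h.1 h1
    exact mul_pos (by linarith) (by linarith)

theorem eval_derivative_nodal_eq {k : ℕ} (α : Fin k → ℝ) {t : ℝ} (hα : ∀ i, t ≠ α i) :
    (derivative (nodal Finset.univ α)).eval t =
      (nodal Finset.univ α).eval t * ∑ i, 1 / (t - α i) := by
  rw [derivative_nodal, eval_finsetSum, Finset.mul_sum]
  refine Finset.sum_congr rfl fun i hi => ?_
  rw [eval_nodal, eval_nodal, ← Finset.mul_prod_erase _ _ hi]
  have := sub_ne_zero.2 (hα i)
  field_simp

/-- The Wronskian is the product of the two polynomials times the difference of their logarithmic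
derivatives. By `Nested.position`, each `β` pairs with an adjacent `α` on the same side of `t`.
Pairs contribute positive factors to the product, and to the sum differences with the sign of the
one unpaired factor, `t - α 0` or `t - α (Fin.last k)`. -/
theorem Nested.wronskian_nonneg_of_ne {k : ℕ} {α : Fin (k + 1) → ℝ} {β : Fin k → ℝ}
    (hn : Nested α β) {t : ℝ} (hα : ∀ i, t ≠ α i) (hβ : ∀ i, t ≠ β i) :
    0 ≤ (derivative (nodal Finset.univ α)).eval t * (nodal Finset.univ β).eval t -
      (nodal Finset.univ α).eval t * (derivative (nodal Finset.univ β)).eval t := by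
  rw [eval_derivative_nodal_eq α hα, eval_derivative_nodal_eq β hβ]
  suffices h : 0 ≤ ((nodal Finset.univ α).eval t * (nodal Finset.univ β).eval t) *
      (∑ i, 1 / (t - α i) - ∑ i, 1 / (t - β i)) by linarith
  rw [eval_nodal, eval_nodal]
  rcases hn.position hα with ⟨h0, h1⟩ | ⟨h0, h1⟩
  · rw [Fin.prod_univ_succ, Fin.sum_univ_succ, mul_assoc (t - α 0), ← Finset.prod_mul_distrib,
      add_sub_assoc, ← Finset.sum_sub_distrib]
    refine mul_nonneg (mul_nonneg (by linarith) (Finset.prod_nonneg fun i _ =>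
      (mul_pos_of_same_side (hα _) (hβ _) (h1 i).symm).le)) (add_nonneg
      (one_div_nonneg.2 (by linarith)) (Finset.sum_nonneg fun i _ => ?_))
    exact sub_nonneg.2 (one_div_sub_le_of_same_side (hn.2.2 i).2 (hβ _) (h1 i))
  · rw [Fin.prod_univ_castSucc, Fin.sum_univ_castSucc,
      mul_right_comm (∏ i : Fin k, (t - α i.castSucc)), ← Finset.prod_mul_distrib,
      add_sub_right_comm, ← Finset.sum_sub_distrib]
    refine mul_nonneg_of_nonpos_of_nonpos (mul_nonpos_of_nonneg_of_nonpos
      (Finset.prod_nonneg fun i _ => (mul_pos_of_same_side (hα _) (hβ _) (h1 i)).le) (by linarith))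
      (add_nonpos (Finset.sum_nonpos fun i _ => ?_) (one_div_nonpos.2 (by linarith)))
    exact sub_nonpos.2 (one_div_sub_le_of_same_side (hn.2.2 i).1 (hα _) (h1 i))

theorem Nested.wronskian_nonneg {k : ℕ} {α : Fin (k + 1) → ℝ} {β : Fin k → ℝ}
    (hn : Nested α β) (t : ℝ) :
    0 ≤ (derivative (nodal Finset.univ α)).eval t * (nodal Finset.univ β).eval t -
      (nodal Finset.univ α).eval t * (derivative (nodal Finset.univ β)).eval t := by
  have hclosed : IsClosed {t : ℝ | 0 ≤
      (derivative (nodal Finset.univ α)).eval t * (nodal Finset.univ β).eval t -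
      (nodal Finset.univ α).eval t * (derivative (nodal Finset.univ β)).eval t} :=
    isClosed_le continuous_const (by fun_prop)
  have hd : Dense (Set.range α ∪ Set.range β)ᶜ :=
    ((Set.finite_range α).union (Set.finite_range β)).countable.dense_compl ℝ
  refine hclosed.closure_subset_iff.2 (fun s hs => ?_) (hd t)
  simp only [Set.mem_compl_iff, Set.mem_union, Set.mem_range, not_or, not_exists] at hs
  exact hn.wronskian_nonneg_of_ne (fun i h => hs.1 i h.symm) (fun i h => hs.2 i h.symm)

theorem UnivInterlaces.wronskian_nonneg {p q : ℝ[X]} (h : UnivInterlaces q p)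
    (hp : 0 ≤ p.leadingCoeff) (hq : 0 ≤ q.leadingCoeff) (t : ℝ) :
    0 ≤ (derivative p).eval t * q.eval t - p.eval t * (derivative q).eval t := by
  obtain ⟨k, α, β, hn, hpα, hqβ⟩ := h.exists_nested
  have := mul_nonneg (mul_nonneg hp hq) (hn.wronskian_nonneg t)
  rw [hpα, hqβ]
  generalize p.leadingCoeff = a at *
  generalize q.leadingCoeff = b at *
  simp only [derivative_C_mul, eval_mul, eval_C]
  linarith

/-- Nested families of points pass to bounded limits. -/
theorem exists_nested_of_tendsto {k : ℕ} {M : ℝ} {α : ℕ → Fin (k + 1) → ℝ} {β : ℕ → Fin k → ℝ}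
    (hn : ∀ n, Nested (α n) (β n)) (hM : ∀ n i, |α n i| ≤ M) {p q : ℝ[X]} {P Q : ℕ → ℝ[X]}
    {a b : ℝ} {c : ℕ → ℝ}
    (hP : ∀ n, P n = C a * nodal Finset.univ (α n))
    (hQ : ∀ n, Q n = C (c n) * nodal Finset.univ (β n))
    (hp : ∀ t, Filter.Tendsto (fun n => (P n).eval t) Filter.atTop (nhds (p.eval t)))
    (hq : ∀ t, Filter.Tendsto (fun n => (Q n).eval t) Filter.atTop (nhds (q.eval t)))
    (hc : Filter.Tendsto c Filter.atTop (nhds b)) :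
    ∃ (x : Fin (k + 1) → ℝ) (y : Fin k → ℝ), Nested x y ∧ p = C a * nodal Finset.univ x ∧
      q = C b * nodal Finset.univ y := by
  -- The bound on `α` also bounds `β`, which lies between its values, so a subsequence of both
  -- families converges.
  have hmem : ∀ n, (α n, β n) ∈ Set.Icc (fun _ => -M : Fin (k + 1) → ℝ) (fun _ => M) ×ˢ
      Set.Icc (fun _ => -M : Fin k → ℝ) (fun _ => M) := fun n =>
    ⟨⟨fun i => (abs_le.1 (hM n i)).1, fun i => (abs_le.1 (hM n i)).2⟩,
      ⟨fun i => (abs_le.1 (hM n _)).1.trans ((hn n).2.2 i).1,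
        fun i => ((hn n).2.2 i).2.trans (abs_le.1 (hM n _)).2⟩⟩
  obtain ⟨⟨x, y⟩, -, φ, hφ, hlim⟩ := (isCompact_Icc.prod isCompact_Icc).tendsto_subseq hmem
  rw [nhds_prod_eq, Filter.tendsto_prod_iff'] at hlim
  have hx : ∀ i, Filter.Tendsto (fun n => α (φ n) i) Filter.atTop (nhds (x i)) :=
    fun i => (tendsto_pi_nhds.1 hlim.1 i)
  have hy : ∀ i, Filter.Tendsto (fun n => β (φ n) i) Filter.atTop (nhds (y i)) :=
    fun i => (tendsto_pi_nhds.1 hlim.2 i)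
  refine ⟨x, y, ⟨fun i j hij => ?_, fun i j hij => ?_, fun i => ⟨?_, ?_⟩⟩, ?_, ?_⟩
  · exact le_of_tendsto_of_tendsto' (hx i) (hx j) fun n => (hn _).1 hij
  · exact le_of_tendsto_of_tendsto' (hy i) (hy j) fun n => (hn _).2.1 hij
  · exact le_of_tendsto_of_tendsto' (hx _) (hy i) fun n => ((hn _).2.2 i).1
  · exact le_of_tendsto_of_tendsto' (hy i) (hx _) fun n => ((hn _).2.2 i).2
  · refine Polynomial.funext fun t => tendsto_nhds_unique ((hp t).comp hφ.tendsto_atTop) ?_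
    simp only [Function.comp_def, hP, eval_mul, eval_C, eval_nodal]
    exact (tendsto_finsetProd _ fun i _ => (hx i).const_sub t).const_mul a
  · refine Polynomial.funext fun t => tendsto_nhds_unique ((hq t).comp hφ.tendsto_atTop) ?_
    simp only [Function.comp_def, hQ, eval_mul, eval_C, eval_nodal]
    exact (hc.comp hφ.tendsto_atTop).mul (tendsto_finsetProd _ fun i _ => (hy i).const_sub t)

theorem pow_card_le_norm_prod_map_sub {z : ℂ} {r : ℝ} (hr : 0 ≤ r) (s : Multiset ℂ)
    (h : ∀ x ∈ s, r ≤ ‖z - x‖) : r ^ s.card ≤ ‖(s.map fun x => z - x).prod‖ := by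
  induction s using Multiset.induction_on with
  | empty => simp
  | cons a s ih =>
    rw [Multiset.card_cons, pow_succ', Multiset.map_cons, Multiset.prod_cons, norm_mul]
    exact mul_le_mul (h a (Multiset.mem_cons_self a s))
      (ih fun x hx => h x (Multiset.mem_cons_of_mem hx)) (pow_nonneg hr _) (norm_nonneg _)

/-- A complex polynomial with a small value at `z` has a root near `z`. -/
theorem exists_root_norm_sub_pow_mul_le {p : ℂ[X]} {d : ℕ} (hd : p.natDegree = d) (hd0 : d ≠ 0)
    (z : ℂ) : ∃ w, p.eval w = 0 ∧ ‖z - w‖ ^ d * ‖p.leadingCoeff‖ ≤ ‖p.eval z‖ := by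
  have hs := IsAlgClosed.splits p
  have hcard : p.roots.card = d := by rw [← hs.natDegree_eq_card_roots, hd]
  have hp0 : p ≠ 0 := by rintro rfl; simp at hd; exact hd0 hd.symm
  obtain ⟨w, hw, hmin⟩ := p.roots.toFinset.exists_min_image (fun w => ‖z - w‖) (by
    rw [Multiset.toFinset_nonempty]; rintro h; simp [h] at hcard; exact hd0 hcard.symm)
  refine ⟨w, (mem_roots'.1 (Multiset.mem_toFinset.1 hw)).2, ?_⟩
  rw [hs.eval_eq_prod_roots z, norm_mul, mul_comm]
  refine mul_le_mul_of_nonneg_left ?_ (norm_nonneg _)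
  rw [← hcard]
  exact pow_card_le_norm_prod_map_sub (norm_nonneg _) _ fun x hx =>
    hmin x (Multiset.mem_toFinset.2 hx)

/-- A complex polynomial whose value at `0` is small compared with its derivative has a root
near `0`. -/
theorem exists_root_norm_mul_le {p : ℂ[X]} {d : ℕ} (hd : p.natDegree ≤ d)
    (h0 : (derivative p).eval 0 ≠ 0) :
    ∃ w, p.eval w = 0 ∧ ‖w‖ * ‖(derivative p).eval 0‖ ≤ d * ‖p.eval 0‖ := by
  by_cases hp0 : p.eval 0 = 0
  · exact ⟨0, hp0, by simp [hp0]⟩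
  have hs := IsAlgClosed.splits p
  -- `p'(0) / p(0)` is a sum of at most `d` terms `1 / (0 - r)` over the roots `r`, each bounded by
  -- `1 / ‖w‖` for the root `w` closest to `0`.
  have hsum := hs.eval_derivative_div_eval_of_ne_zero hp0
  obtain ⟨w, hw, hmin⟩ := p.roots.toFinset.exists_min_image (fun w => ‖w‖) (by
    rw [Multiset.toFinset_nonempty]; rintro h; simp [h, hp0] at hsum; exact h0 hsum)
  have hwr : p.eval w = 0 := (mem_roots'.1 (Multiset.mem_toFinset.1 hw)).2
  have hw0 : 0 < ‖w‖ := norm_pos_iff.2 (by rintro rfl; exact hp0 hwr)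
  refine ⟨w, hwr, ?_⟩
  have hle : ‖(derivative p).eval 0 / p.eval 0‖ ≤ d * (1 / ‖w‖) := by
    rw [hsum]
    refine (norm_multiset_sum_le _).trans ?_
    rw [Multiset.map_map]
    refine (Multiset.sum_le_card_nsmul _ (1 / ‖w‖) ?_).trans ?_
    · intro x hx
      obtain ⟨r, hr, rfl⟩ := Multiset.mem_map.1 hx
      simp only [Function.comp_apply, zero_sub, norm_div, norm_one, norm_neg]
      exact one_div_le_one_div_of_le hw0 (hmin r (Multiset.mem_toFinset.2 hr))
    · rw [Multiset.card_map, nsmul_eq_mul, ← hs.natDegree_eq_card_roots]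
      gcongr
  rw [norm_div, div_le_iff₀ (norm_pos_iff.2 hp0)] at hle
  calc ‖w‖ * ‖(derivative p).eval 0‖ ≤ ‖w‖ * (d * (1 / ‖w‖) * ‖p.eval 0‖) := by gcongr
    _ = d * ‖p.eval 0‖ := by field_simp

theorem RealRooted.exists_strictMono_of_isCoprime {p : ℝ[X]} {m : ℕ} (hp : RealRooted p)
    (hm : p.natDegree = m) (hc : IsCoprime p (derivative p)) :
    ∃ α : Fin m → ℝ, StrictMono α ∧ p = C p.leadingCoeff * nodal Finset.univ α := by
  have hsep : p.Separable := hc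
  have hnd := nodup_roots hsep
  have hcard : p.roots.toFinset.card = m := by
    rw [Multiset.toFinset_card_of_nodup hnd, ← hp.splits.natDegree_eq_card_roots, hm]
  refine ⟨p.roots.toFinset.orderEmbOfFin hcard, (Finset.orderEmbOfFin _ hcard).strictMono,
    eq_C_mul_nodal_of_roots hm ?_⟩
  have h1 : Finset.univ.map (p.roots.toFinset.orderEmbOfFin hcard).toEmbedding = p.roots.toFinset :=
    Finset.map_orderEmbOfFin_univ _ hcard
  have h2 := congrArg Finset.val h1
  rw [Multiset.toFinset_val, hnd.dedup] at h2
  exact h2.symm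

/-- Every other node lies on the same side of two consecutive ones and contributes a positive
factor; only the two mutual differences have opposite signs. -/
theorem eval_derivative_nodal_mul_neg {k : ℕ} {α : Fin (k + 1) → ℝ} (hα : StrictMono α)
    (i : Fin k) : (derivative (nodal Finset.univ α)).eval (α i.castSucc) *
      (derivative (nodal Finset.univ α)).eval (α i.succ) < 0 := by
  have hlt : α i.castSucc < α i.succ := hα i.castSucc_lt_succ
  have hne : i.succ ≠ i.castSucc := i.castSucc_lt_succ.ne'
  rw [eval_nodal_derivative_eval_node_eq (Finset.mem_univ _),
    eval_nodal_derivative_eval_node_eq (Finset.mem_univ _), eval_nodal, eval_nodal,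
    ← Finset.mul_prod_erase _ _ (Finset.mem_erase.2 ⟨hne, Finset.mem_univ _⟩),
    ← Finset.mul_prod_erase (Finset.univ.erase i.succ) _
      (Finset.mem_erase.2 ⟨hne.symm, Finset.mem_univ _⟩),
    Finset.erase_right_comm, mul_mul_mul_comm, ← Finset.prod_mul_distrib]
  refine mul_neg_of_neg_of_pos (mul_neg_of_neg_of_pos (by linarith) (by linarith))
    (Finset.prod_pos fun j hj => ?_)
  simp only [Finset.mem_erase, Finset.mem_univ, and_true] at hj
  rcases lt_or_ge j i.succ with h | h
  · have h1 : α j < α i.castSucc := hα (lt_of_le_of_ne (Fin.le_castSucc_iff.2 h) (by tauto))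
    exact mul_pos (by linarith) (by linarith)
  · have h1 : α i.succ < α j := hα (lt_of_le_of_ne h (by tauto))
    exact mul_pos_of_neg_of_neg (by linarith) (by linarith)

/-- Sign alternation at the simple roots of `p` forces the roots of `q` to interlace. -/
theorem exists_nested_of_derivative_mul_pos {k : ℕ} {α : Fin (k + 1) → ℝ} (hα : StrictMono α)
    {q : ℝ[X]} (hq : q.natDegree ≤ k)
    (hpos : ∀ i, 0 < (derivative (nodal Finset.univ α)).eval (α i) * q.eval (α i)) :
    ∃ β : Fin k → ℝ, Nested α β ∧ q = C (q.coeff k) * nodal Finset.univ β := by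
  have hroot : ∀ i : Fin k, ∃ b ∈ Set.Ioo (α i.castSucc) (α i.succ), q.eval b = 0 := by
    intro i
    have hlt : α i.castSucc < α i.succ := hα i.castSucc_lt_succ
    have h1 := hpos i.castSucc
    have h2 := hpos i.succ
    have h3 := eval_derivative_nodal_mul_neg hα i
    have hcont : ContinuousOn (fun t => q.eval t) (Set.Icc (α i.castSucc) (α i.succ)) :=
      q.continuous.continuousOn
    rcases mul_pos_iff.1 h1 with ⟨h4, h5⟩ | ⟨h4, h5⟩
    · have h6 : q.eval (α i.succ) < 0 := by
        have h7 := neg_of_mul_neg_right h3 h4.le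
        exact neg_of_mul_pos_right h2 h7.le
      exact intermediate_value_Ioo' hlt.le hcont ⟨h6, h5⟩
    · have h6 : 0 < q.eval (α i.succ) := by
        have h7 := pos_of_mul_neg_right h3 h4.le
        exact pos_of_mul_pos_right h2 h7.le
      exact intermediate_value_Ioo hlt.le hcont ⟨h5, h6⟩
  choose β hβ hβ0 using hroot
  have hβm : StrictMono β := by
    intro i j hij
    refine (hβ i).2.trans_le (le_trans (hα.monotone ?_) (hβ j).1.le)
    rw [Fin.le_def]; simpa [Nat.succ_le_iff] using hij
  refine ⟨β, ⟨hα.monotone, hβm.monotone, fun i => ⟨(hβ i).1.le, (hβ i).2.le⟩⟩, ?_⟩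
  -- The `k` gaps give `k` distinct roots, so the bound `k` on the degree leaves only a constant
  -- cofactor.
  have hdvd : nodal Finset.univ β ∣ q := by
    rw [nodal_eq]
    refine Finset.prod_dvd_of_coprime (fun i _ j _ hij => ?_) fun i _ => dvd_iff_isRoot.2 (hβ0 i)
    exact pairwise_coprime_X_sub_C hβm.injective hij
  obtain ⟨r, hr⟩ := hdvd
  have hmonic : (nodal Finset.univ β).Monic := nodal_monic
  have hnd : (nodal Finset.univ β).natDegree = k := by simp [natDegree_nodal]
  have hr0 : r.natDegree = 0 := by
    by_cases h0 : r = 0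
    · simp [h0]
    · rw [hr, hmonic.natDegree_mul' h0, hnd] at hq
      omega
  obtain ⟨b, rfl⟩ := natDegree_eq_zero.1 hr0
  have hb : q.coeff k = b := by
    rw [hr, coeff_mul_C]
    have := hmonic.coeff_natDegree
    rw [hnd] at this
    rw [this, one_mul]
  rw [hb, hr, mul_comm]

/-- By Lagrange interpolation, the top coefficient of `q` is nonnegative when `q` is compatible
with the signs of the derivative at the roots of `nodal α`; it vanishes only for `q = 0`. -/
theorem coeff_pos_of_derivative_mul_nonneg {k : ℕ} {α : Fin (k + 1) → ℝ} (hα : StrictMono α)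
    {q : ℝ[X]} (hq : q.natDegree ≤ k) (hq0 : q ≠ 0)
    (hpos : ∀ i, 0 ≤ (derivative (nodal Finset.univ α)).eval (α i) * q.eval (α i)) :
    0 < q.coeff k := by
  have hdeg : q.degree < (Finset.univ : Finset (Fin (k + 1))).card := by
    rw [Finset.card_univ, Fintype.card_fin]
    exact (degree_le_of_natDegree_le hq).trans_lt (by exact_mod_cast Nat.lt_succ_self k)
  have hsum := coeff_eq_sum (s := Finset.univ) (v := α) hα.injective.injOn hdeg
  rw [Finset.card_univ, Fintype.card_fin, Nat.add_sub_cancel] at hsum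
  -- The interpolation denominators are the derivatives of the nodal polynomial at its nodes, so
  -- each term has the sign controlled by `hpos`.
  have hterm : ∀ i, eval (α i) q / ∏ j ∈ Finset.univ.erase i, (α i - α j) =
      ((derivative (nodal Finset.univ α)).eval (α i) * q.eval (α i)) /
        (∏ j ∈ Finset.univ.erase i, (α i - α j)) ^ 2 := by
    intro i
    have hne : ∏ j ∈ Finset.univ.erase i, (α i - α j) ≠ 0 := Finset.prod_ne_zero_iff.2 fun j hj =>
      sub_ne_zero.2 (hα.injective.ne (Finset.ne_of_mem_erase hj).symm)
    rw [eval_nodal_derivative_eval_node_eq (Finset.mem_univ _), eval_nodal]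
    field_simp
  have hnn : ∀ i ∈ Finset.univ, 0 ≤ eval (α i) q / ∏ j ∈ Finset.univ.erase i, (α i - α j) := by
    intro i _
    rw [hterm]
    exact div_nonneg (hpos i) (sq_nonneg _)
  rw [hsum]
  refine lt_of_le_of_ne (Finset.sum_nonneg hnn) fun h0 => hq0 ?_
  have h0' := (Finset.sum_eq_zero_iff_of_nonneg hnn).1 h0.symm
  refine eq_zero_of_degree_lt_of_eval_finset_eq_zero (Finset.univ.image α) ?_ ?_
  · rwa [Finset.card_image_of_injective _ hα.injective]
  · intro x hx
    obtain ⟨i, -, rfl⟩ := Finset.mem_image.1 hx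
    have hne : ∏ j ∈ Finset.univ.erase i, (α i - α j) ≠ 0 := Finset.prod_ne_zero_iff.2 fun j hj =>
      sub_ne_zero.2 (hα.injective.ne (Finset.ne_of_mem_erase hj).symm)
    exact (div_eq_zero_iff.1 (h0' i (Finset.mem_univ i))).resolve_right hne

end Univariate

/-! ### Restriction to lines over an arbitrary `ℝ`-algebra (later `ℝ`, `ℂ` and the polynomial ring
itself). -/

section Lines

open MvPolynomial

variable {n d : ℕ} {A : Type*} [CommRing A] [Algebra ℝ A]

/-- The univariate polynomial `f(t u + v)` over an `ℝ`-algebra. -/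
noncomputable def linePoly (u v : Fin n → A) (f : MvPolynomial (Fin n) ℝ) : Polynomial A :=
  aeval (fun i => Polynomial.X * Polynomial.C (u i) + Polynomial.C (v i)) f

theorem lineRestrict_eq_linePoly (f : MvPolynomial (Fin n) ℝ) (e a : Fin n → ℝ) :
    lineRestrict f e a = linePoly e a f := rfl

theorem eval_linePoly (u v : Fin n → A) (f : MvPolynomial (Fin n) ℝ) (t : A) :
    (linePoly u v f).eval t = aeval (t • u + v) f := by
  have h : (Polynomial.aeval (R := A) t).restrictScalars ℝ (linePoly u v f) =
      aeval (t • u + v) f := by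
    rw [linePoly, ← AlgHom.comp_apply, MvPolynomial.comp_aeval]
    congr 2
    ext i
    simp
    ring
  simpa using h

theorem map_linePoly {B : Type*} [CommRing B] [Algebra ℝ B] (φ : A →ₐ[ℝ] B) (u v : Fin n → A)
    (f : MvPolynomial (Fin n) ℝ) :
    (linePoly u v f).map (φ : A →+* B) = linePoly (φ ∘ u) (φ ∘ v) f := by
  have h : Polynomial.mapAlgHom φ (linePoly u v f) = linePoly (φ ∘ u) (φ ∘ v) f := by
    rw [linePoly, ← AlgHom.comp_apply, MvPolynomial.comp_aeval, linePoly]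
    congr 2
    ext i
    simp
  simpa using h

theorem dirDeriv_mul (e : Fin n → ℝ) (p q : MvPolynomial (Fin n) ℝ) :
    dirDeriv e (p * q) = dirDeriv e p * q + p * dirDeriv e q := by
  simp only [dirDeriv, Derivation.leibniz, smul_eq_mul, Finset.sum_mul, Finset.mul_sum,
    ← Finset.sum_add_distrib]
  exact Finset.sum_congr rfl fun i _ => by ring

theorem dirDeriv_X (e : Fin n → ℝ) (i : Fin n) : dirDeriv e (X i) = C (e i) := by
  simp [dirDeriv, pderiv_X, Pi.single_apply]

theorem derivative_linePoly (e : Fin n → ℝ) (v : Fin n → A) (f : MvPolynomial (Fin n) ℝ) :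
    Polynomial.derivative (linePoly (algebraMap ℝ A ∘ e) v f) =
      linePoly (algebraMap ℝ A ∘ e) v (dirDeriv e f) := by
  induction f using MvPolynomial.induction_on with
  | C a => simp [linePoly, dirDeriv, Polynomial.algebraMap_apply]
  | add p q hp hq =>
    simp only [linePoly, dirDeriv, map_add, mul_add, Finset.sum_add_distrib] at *
    rw [hp, hq]
  | mul_X p i hp =>
    rw [dirDeriv_mul, dirDeriv_X]
    simp only [linePoly] at *
    simp only [map_mul, map_add, aeval_X, Polynomial.derivative_mul, hp]
    simp [Polynomial.algebraMap_apply]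

theorem natDegree_prod_pow_le_and_coeff {A : Type*} [CommRing A]
    {p : Fin n → Polynomial A} (hp : ∀ i, (p i).natDegree ≤ 1)
    (m : Fin n → ℕ) (s : Finset (Fin n)) :
    (∏ i ∈ s, p i ^ m i).natDegree ≤ ∑ i ∈ s, m i ∧
      (∏ i ∈ s, p i ^ m i).coeff (∑ i ∈ s, m i) = ∏ i ∈ s, (p i).coeff 1 ^ m i := by
  induction s using Finset.induction_on with
  | empty => simp
  | insert a s ha ih =>
    have h1 : (p a ^ m a).natDegree ≤ m a := by
      simpa using Polynomial.natDegree_pow_le_of_le (m a) (hp a)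
    have h2 : (p a ^ m a).coeff (m a) = (p a).coeff 1 ^ m a := by
      simpa using Polynomial.coeff_pow_of_natDegree_le (m := m a) (hp a)
    rw [Finset.prod_insert ha, Finset.sum_insert ha, Finset.prod_insert ha]
    refine ⟨Polynomial.natDegree_mul_le_of_le h1 ih.1, ?_⟩
    rw [Polynomial.coeff_mul_add_eq_of_natDegree_le h1 ih.1, h2, ih.2]

theorem natDegree_linePoly_le_and_coeff {f : MvPolynomial (Fin n) ℝ} (hf : f.IsHomogeneous d)
    (u v : Fin n → A) :
    (linePoly u v f).natDegree ≤ d ∧ (linePoly u v f).coeff d = aeval u f := by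
  have key := fun m : Fin n →₀ ℕ => natDegree_prod_pow_le_and_coeff
    (p := fun i => Polynomial.X * Polynomial.C (u i) + Polynomial.C (v i))
    (fun i => by compute_degree) m Finset.univ
  have hdeg : ∀ m ∈ f.support, ∑ i, m i = d := fun m hm => by
    rw [← Finsupp.degree_eq_sum]
    exact (hf.degree_eq_sum_deg_support hm).symm
  rw [linePoly, aeval_def, eval₂_eq', aeval_def, eval₂_eq', Polynomial.finsetSum_coeff]
  simp only [Polynomial.algebraMap_apply]
  refine ⟨Polynomial.natDegree_sum_le_of_forall_le _ _ fun m hm => ?_,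
    Finset.sum_congr rfl fun m hm => ?_⟩
  · refine (Polynomial.natDegree_C_mul_le _ _).trans ?_
    exact (key m).1.trans (hdeg m hm).le
  · rw [Polynomial.coeff_C_mul, ← hdeg m hm, (key m).2]
    simp

theorem natDegree_linePoly {f : MvPolynomial (Fin n) ℝ} (hf : f.IsHomogeneous d)
    {u : Fin n → A} (hu : aeval u f ≠ 0) (v : Fin n → A) : (linePoly u v f).natDegree = d := by
  obtain ⟨h1, h2⟩ := natDegree_linePoly_le_and_coeff hf u v
  exact le_antisymm h1 (Polynomial.le_natDegree_of_ne_zero (by rwa [h2]))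

theorem leadingCoeff_linePoly {f : MvPolynomial (Fin n) ℝ} (hf : f.IsHomogeneous d)
    {u : Fin n → A} (hu : aeval u f ≠ 0) (v : Fin n → A) :
    (linePoly u v f).leadingCoeff = aeval u f := by
  rw [Polynomial.leadingCoeff, natDegree_linePoly hf hu,
    (natDegree_linePoly_le_and_coeff hf u v).2]

theorem aeval_smul_of_isHomogeneous {f : MvPolynomial (Fin n) ℝ} (hf : f.IsHomogeneous d)
    (c : A) (z : Fin n → A) : aeval (c • z) f = c ^ d * aeval z f := by
  rw [aeval_def, eval₂_eq', aeval_def, eval₂_eq', Finset.mul_sum]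
  refine Finset.sum_congr rfl fun m hm => ?_
  have hdeg : ∑ i, m i = d := by
    rw [← Finsupp.degree_eq_sum]
    exact (hf.degree_eq_sum_deg_support hm).symm
  simp only [Pi.smul_apply, smul_eq_mul, mul_pow, Finset.prod_mul_distrib,
    Finset.prod_pow_eq_pow_sum, hdeg]
  ring

theorem dirDeriv_isHomogeneous {f : MvPolynomial (Fin n) ℝ} (hf : f.IsHomogeneous d)
    (e : Fin n → ℝ) : (dirDeriv e f).IsHomogeneous (d - 1) :=
  IsHomogeneous.sum _ _ _ fun i _ => (hf.pderiv).C_mul (e i)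

end Lines

/-! ### Stability at complex points and Gårding's theorem on the hyperbolicity cone. -/

section ComplexPoints

open MvPolynomial Filter Topology

variable {n d : ℕ} {f : MvPolynomial (Fin n) ℝ}

/-- A real vector viewed as a complex one. -/
def toComplex (x : Fin n → ℝ) : Fin n → ℂ := fun i => (x i : ℂ)

theorem continuous_toComplex : Continuous (toComplex : (Fin n → ℝ) → Fin n → ℂ) :=
  continuous_pi fun i => Complex.continuous_ofReal.comp (continuous_apply i)

theorem toComplex_add (x y : Fin n → ℝ) : toComplex (x + y) = toComplex x + toComplex y := by
  ext i; simp [toComplex]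

theorem toComplex_smul (c : ℝ) (x : Fin n → ℝ) : toComplex (c • x) = (c : ℂ) • toComplex x := by
  ext i; simp [toComplex]

theorem aeval_toComplex (x : Fin n → ℝ) (f : MvPolynomial (Fin n) ℝ) :
    aeval (toComplex x) f = ((eval x f : ℝ) : ℂ) := by
  have h := MvPolynomial.aeval_algebraMap_apply ℂ x f
  change aeval (fun i => (x i : ℂ)) f = _
  simpa [Function.comp_def] using h

theorem continuous_aeval_point {A : Type*} [CommRing A] [Algebra ℝ A] [TopologicalSpace A]
    [IsTopologicalRing A] (f : MvPolynomial (Fin n) ℝ) :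
    Continuous fun z : Fin n → A => aeval z f := by
  simp only [aeval_def, eval₂_eq']
  fun_prop

theorem aeval_lineRestrict (f : MvPolynomial (Fin n) ℝ) (e a : Fin n → ℝ) (z : ℂ) :
    Polynomial.aeval z (lineRestrict f e a) = aeval (z • toComplex e + toComplex a) f := by
  have h := map_linePoly (Algebra.ofId ℝ ℂ) e a f
  rw [← Polynomial.eval_map_algebraMap, lineRestrict_eq_linePoly]
  exact (congrArg (Polynomial.eval z) h).trans (eval_linePoly _ _ _ _)

/-- The zeros of `f` on the lines with direction `u` are controlled by the base point. -/
theorem exists_root_bound {𝕜 : Type*} [NormedField 𝕜] [NormedAlgebra ℝ 𝕜]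
    (hf : f.IsHomogeneous d) {u : Fin n → 𝕜} (hu : aeval u f ≠ 0) :
    ∃ M : ℝ, 0 ≤ M ∧ ∀ (v : Fin n → 𝕜) (t : 𝕜), aeval (t • u + v) f = 0 → ‖t‖ ≤ M * ‖v‖ := by
  have hnear : ∀ᶠ z in 𝓝 u, aeval z f ≠ 0 :=
    (continuous_aeval_point f).continuousAt.eventually_ne hu
  obtain ⟨r, hr, hball⟩ := Metric.eventually_nhds_iff_ball.1 hnear
  refine ⟨r⁻¹, inv_nonneg.2 hr.le, fun v t h0 => ?_⟩
  by_cases ht : t = 0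
  · simpa [ht] using mul_nonneg (inv_nonneg.2 hr.le) (norm_nonneg v)
  -- By homogeneity a zero at `t • u + v` is a zero at `u + t⁻¹ • v`, which must stay outside a ball
  -- around `u` free of zeros.
  have hz : t • u + v = t • (u + t⁻¹ • v) := by
    rw [smul_add, smul_inv_smul₀ ht]
  rw [hz, aeval_smul_of_isHomogeneous hf] at h0
  have h1 : u + t⁻¹ • v ∉ Metric.ball u r := fun hmem =>
    hball _ hmem ((mul_eq_zero.1 h0).resolve_left (pow_ne_zero _ ht))
  rw [mem_ball_iff_norm, add_sub_cancel_left, norm_smul, norm_inv, not_lt] at h1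
  have ht' : 0 < ‖t‖ := norm_pos_iff.2 ht
  rw [inv_mul_eq_div, le_div_iff₀ ht'] at h1
  rw [inv_mul_eq_div, le_div_iff₀ hr]
  linarith

/-- Zeros of `f` on lines persist under small perturbations of the line. -/
theorem eventually_exists_root_near {ι : Type*} {l : Filter ι} (hf : f.IsHomogeneous d)
    (hd : d ≠ 0) {u v : ι → Fin n → ℂ} {u₀ v₀ : Fin n → ℂ} (hu : Tendsto u l (𝓝 u₀))
    (hv : Tendsto v l (𝓝 v₀)) {t₀ : ℂ} (h0 : aeval (t₀ • u₀ + v₀) f = 0) (hu0 : aeval u₀ f ≠ 0)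
    {ε : ℝ} (hε : 0 < ε) :
    ∀ᶠ i in l, ∃ t, ‖t₀ - t‖ < ε ∧ aeval (t • u i + v i) f = 0 := by
  have hcont := continuous_aeval_point (A := ℂ) f
  have h1 : Tendsto (fun i => ‖aeval (t₀ • u i + v i) f‖) l (𝓝 0) := by
    have := ((hcont.tendsto _).comp ((hu.const_smul t₀).add hv)).norm
    rwa [h0, norm_zero] at this
  have h2 : Tendsto (fun i => ε ^ d * ‖aeval (u i) f‖) l (𝓝 (ε ^ d * ‖aeval u₀ f‖)) :=
    (((hcont.tendsto _).comp hu).norm).const_mul _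
  have h3 : 0 < ε ^ d * ‖aeval u₀ f‖ := mul_pos (pow_pos hε d) (norm_pos_iff.2 hu0)
  filter_upwards [h1.eventually_lt h2 h3, ((hcont.tendsto _).comp hu).eventually_ne hu0]
    with i hi hne
  obtain ⟨w, hw, hle⟩ := exists_root_norm_sub_pow_mul_le (natDegree_linePoly hf hne (v i)) hd t₀
  rw [leadingCoeff_linePoly hf hne, eval_linePoly] at hle
  rw [eval_linePoly] at hw
  refine ⟨w, ?_, hw⟩
  have h4 := lt_of_mul_lt_mul_right (hle.trans_lt hi) (norm_nonneg _)
  exact lt_of_pow_lt_pow_left₀ d hε.le h4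

/-- `f` does not vanish at complex points with imaginary part `y`. -/
def StableAt (f : MvPolynomial (Fin n) ℝ) (y : Fin n → ℝ) : Prop :=
  ∀ x : Fin n → ℝ, aeval (toComplex x + Complex.I • toComplex y) f ≠ 0

theorem aeval_real_smul_eq_zero_iff (hf : f.IsHomogeneous d) {c : ℝ} (hc : c ≠ 0)
    (z : Fin n → ℂ) : aeval ((c : ℂ) • z) f = 0 ↔ aeval z f = 0 := by
  rw [aeval_smul_of_isHomogeneous hf, mul_eq_zero, or_iff_right]
  exact pow_ne_zero _ (by exact_mod_cast hc)

theorem StableAt.smul (hf : f.IsHomogeneous d) {y : Fin n → ℝ} (h : StableAt f y) {c : ℝ}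
    (hc : c ≠ 0) : StableAt f (c • y) := by
  intro x hx
  refine h (c⁻¹ • x) ((aeval_real_smul_eq_zero_iff hf hc _).1 ?_)
  rw [smul_add, ← toComplex_smul, smul_inv_smul₀ hc, smul_comm, ← toComplex_smul]
  exact hx

theorem StableAt.eval_ne_zero (hf : f.IsHomogeneous d) {y : Fin n → ℝ} (h : StableAt f y) :
    eval y f ≠ 0 := by
  intro h0
  refine h 0 ?_
  have : toComplex (0 : Fin n → ℝ) = 0 := by ext; simp [toComplex]
  rw [this, zero_add, aeval_smul_of_isHomogeneous hf, aeval_toComplex, h0]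
  simp

/-- The point `t y + x` has imaginary part `(Im t) y`, a nonzero multiple of `y` when `t` is not
real; the multiple may be negative. -/
theorem StableAt.im_eq_zero (hf : f.IsHomogeneous d) {y : Fin n → ℝ} (h : StableAt f y)
    {x : Fin n → ℝ} {t : ℂ} (ht : aeval (t • toComplex y + toComplex x) f = 0) : t.im = 0 := by
  by_contra hne
  refine h.smul hf hne (t.re • y + x) ?_
  rw [← ht]
  congr 2
  rw [toComplex_add, toComplex_smul, toComplex_smul]
  nth_rewrite 3 [← Complex.re_add_im t]
  module

theorem stableAt_iff (hf : f.IsHomogeneous d) {y : Fin n → ℝ} :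
    StableAt f y ↔ eval y f ≠ 0 ∧ ∀ a, RealRooted (lineRestrict f y a) := by
  constructor
  · intro h
    refine ⟨h.eval_ne_zero hf, fun a z hz => ?_⟩
    rw [aeval_lineRestrict] at hz
    exact h.im_eq_zero hf hz
  · rintro ⟨-, h⟩ x hx
    have := h x Complex.I (by rw [aeval_lineRestrict, add_comm]; exact hx)
    simp at this

/-- A homotopy argument. After adding `iδ y` to the base point, move the real part `s x` from `s =
0` to `s = 1`: roots `t` of `f(t y' + s x + iδ y)` cannot cross the real axis, and at `s = 0` none
lies in the upper half plane. Letting `δ → 0` excludes the root `t = i` at `x`. -/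
theorem StableAt.of_forall_add_smul_ne_zero (hf : f.IsHomogeneous d) (hd : d ≠ 0)
    {y y' : Fin n → ℝ} (h : StableAt f y) (hy' : ∀ s : ℝ, 0 ≤ s → eval (y' + s • y) f ≠ 0) :
    StableAt f y' := by
  have hy0 : aeval (toComplex y') f ≠ 0 := by
    rw [aeval_toComplex]; exact_mod_cast (by simpa using hy' 0 le_rfl)
  intro x hx
  have key : ∀ δ : ℝ, 0 < δ → ∀ t : ℂ, 0 < t.im →
      aeval (t • toComplex y' + (toComplex x + ((δ : ℂ) * Complex.I) • toComplex y)) f ≠ 0 := by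
    intro δ hδ
    set v : ℝ → Fin n → ℂ := fun s => toComplex (s • x) + ((δ : ℂ) * Complex.I) • toComplex y
      with hv
    have hvc : Continuous v :=
      (continuous_toComplex.comp (continuous_id.smul continuous_const)).add continuous_const
    -- A real root would be a zero of `f` with imaginary part `δ y`.
    have hreal : ∀ (s : ℝ) (t : ℂ), aeval (t • toComplex y' + v s) f = 0 → t.im ≠ 0 := by
      intro s t h0 ht
      refine h.smul hf hδ.ne' (t.re • y' + s • x) ?_
      rw [← h0]
      congr 2
      simp only [hv]
      rw [toComplex_add, toComplex_smul t.re, toComplex_smul δ]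
      nth_rewrite 2 [← Complex.re_add_im t]
      rw [ht]
      simp only [Complex.ofReal_zero]
      module
    set S : Set ℝ := {s | ∃ t : ℂ, 0 < t.im ∧ aeval (t • toComplex y' + v s) f = 0} with hS
    have hopen : IsOpen S := by
      rw [isOpen_iff_mem_nhds]
      rintro s ⟨t, ht, h0⟩
      filter_upwards [eventually_exists_root_near hf hd (tendsto_const_nhds (x := toComplex y'))
        (hvc.tendsto s) h0 hy0 ht] with s' hs'
      obtain ⟨t', ht', h0'⟩ := hs'
      refine ⟨t', ?_, h0'⟩
      have := (Complex.abs_im_le_norm (t - t')).trans_lt ht'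
      rw [Complex.sub_im] at this
      linarith [(abs_lt.1 this).2]
    -- The roots stay bounded, so they have a limit point in the closed upper half plane, and
    -- `hreal` keeps it off the axis.
    have hclosed : IsClosed S := by
      obtain ⟨M, hM0, hM⟩ := exists_root_bound hf hy0
      refine IsSeqClosed.isClosed fun s s₀ hs hlim => ?_
      choose t ht h0 using hs
      obtain ⟨B, hB⟩ := ((hvc.tendsto s₀).comp hlim).norm.bddAbove_range
      have hbd : ∀ k, t k ∈ Metric.closedBall (0 : ℂ) (M * B) := fun k => by
        rw [mem_closedBall_zero_iff]
        exact (hM _ _ (h0 k)).trans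
          (mul_le_mul_of_nonneg_left (hB (Set.mem_range_self k)) hM0)
      obtain ⟨t₀, -, φ, hφ, hlim'⟩ := (isCompact_closedBall (0 : ℂ) (M * B)).tendsto_subseq hbd
      have hz : aeval (t₀ • toComplex y' + v s₀) f = 0 := by
        have h1 : Tendsto (fun k => aeval (t (φ k) • toComplex y' + v (s (φ k))) f) atTop
            (𝓝 (aeval (t₀ • toComplex y' + v s₀) f)) :=
          ((continuous_aeval_point f).tendsto _).comp ((hlim'.smul_const _).add
            (((hvc.tendsto s₀).comp hlim).comp hφ.tendsto_atTop))
        refine tendsto_nhds_unique h1 ?_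
        simp only [h0]
        exact tendsto_const_nhds
      have him : 0 ≤ t₀.im :=
        ge_of_tendsto' ((Complex.continuous_im.tendsto _).comp hlim') fun k => (ht (φ k)).le
      exact ⟨t₀, lt_of_le_of_ne him (hreal s₀ t₀ hz).symm, hz⟩
    have h0S : (0 : ℝ) ∉ S := by
      rintro ⟨t, ht, h0⟩
      have ht0 : t ≠ 0 := by rintro rfl; simp at ht
      -- Dividing by `t` turns the zero into a root `w` of `f(w y + y')`. It is real by stability at
      -- `y`, and `Im t > 0` makes `Re w ≥ 0`, against `hy'`.
      set w : ℂ := δ * Complex.I / t with hw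
      have hv0 : t • toComplex y' + v 0 = t • (w • toComplex y + toComplex y') := by
        have : toComplex (0 : Fin n → ℝ) = 0 := by ext; simp [toComplex]
        simp only [hv, zero_smul, this, zero_add, smul_add, smul_smul, hw, mul_div_cancel₀ _ ht0]
        rw [add_comm]
      rw [hv0, aeval_smul_of_isHomogeneous hf] at h0
      have h1 := (mul_eq_zero.1 h0).resolve_left (pow_ne_zero _ ht0)
      have him := h.im_eq_zero hf h1
      have hre : 0 ≤ w.re := by
        rw [hw, Complex.div_re]
        simp only [Complex.mul_re, Complex.ofReal_re, Complex.I_re, mul_zero, Complex.ofReal_im,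
          Complex.I_im, Complex.mul_im]
        have := Complex.normSq_nonneg t
        simp
        positivity
      have hwr : w = (w.re : ℂ) := Complex.ext (by simp) (by simp [him])
      refine hy' w.re hre ?_
      rw [hwr, ← toComplex_smul, ← toComplex_add, aeval_toComplex, add_comm] at h1
      exact_mod_cast h1
    have hempty : S = ∅ := (isClopen_iff.1 ⟨hclosed, hopen⟩).resolve_right fun hu =>
      h0S (hu ▸ Set.mem_univ _)
    intro t ht h0
    have : (1 : ℝ) ∈ S := ⟨t, ht, by simpa [hv] using h0⟩
    rw [hempty] at this
    exact this
  have hv : Tendsto (fun δ : ℝ => toComplex x + ((δ : ℂ) * Complex.I) • toComplex y)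
      (𝓝[>] 0) (𝓝 (toComplex x)) := by
    have hc : Continuous fun δ : ℝ => toComplex x + ((δ : ℂ) * Complex.I) • toComplex y := by
      fun_prop
    have := (hc.tendsto 0).mono_left (nhdsWithin_le_nhds (s := Set.Ioi 0))
    simpa using this
  have hI : aeval (Complex.I • toComplex y' + toComplex x) f = 0 := by rw [add_comm]; exact hx
  obtain ⟨δ, ⟨t, ht, h0⟩, hδ⟩ := ((eventually_exists_root_near hf hd
    (tendsto_const_nhds (x := toComplex y')) hv hI hy0 one_pos).and self_mem_nhdsWithin).exists
  refine key δ hδ t ?_ h0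
  have := (Complex.abs_im_le_norm (Complex.I - t)).trans_lt ht
  rw [Complex.sub_im, Complex.I_im] at this
  linarith [(abs_lt.1 this).2]

/-- Up to a positive factor, `y' + s y` is a point between `y` and `y'`; a ball around `y` free of
zeros of `f` therefore meets the ray criterion. -/
theorem StableAt.eventually (hf : f.IsHomogeneous d) (hd : d ≠ 0) {y : Fin n → ℝ}
    (h : StableAt f y) : ∀ᶠ y' in 𝓝 y, StableAt f y' := by
  have hnear : ∀ᶠ z in 𝓝 y, eval z f ≠ 0 :=
    (MvPolynomial.continuous_eval f).continuousAt.eventually_ne (h.eval_ne_zero hf)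
  obtain ⟨r, hr, hball⟩ := Metric.eventually_nhds_iff_ball.1 hnear
  filter_upwards [Metric.ball_mem_nhds y hr] with y' hy'
  refine h.of_forall_add_smul_ne_zero hf hd fun s hs h0 => ?_
  have hs1 : (1 + s) ≠ 0 := by positivity
  have hz : y' + s • y = (1 + s) • (y + (1 + s)⁻¹ • (y' - y)) := by
    rw [smul_add, smul_inv_smul₀ hs1]
    module
  have hmul : eval _ f = (1 + s) ^ d * eval _ f :=
    aeval_smul_of_isHomogeneous hf (1 + s) (y + (1 + s)⁻¹ • (y' - y))
  rw [← hz, h0] at hmul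
  refine hball _ ?_ ((mul_eq_zero.1 hmul.symm).resolve_left (pow_ne_zero _ hs1))
  rw [mem_ball_iff_norm] at hy' ⊢
  rw [add_sub_cancel_left, norm_smul, norm_inv, Real.norm_of_nonneg (by positivity)]
  refine lt_of_le_of_lt ?_ hy'
  exact mul_le_of_le_one_left (norm_nonneg _) (inv_le_one_of_one_le₀ (by linarith))

/-- A root at `t = i` would persist as a nonreal root for nearby stable directions. The condition
`f(y) ≠ 0` keeps the degree from dropping. -/
theorem StableAt.of_mem_closure (hf : f.IsHomogeneous d) (hd : d ≠ 0) {y : Fin n → ℝ}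
    (h : y ∈ closure {y | StableAt f y}) (hy : eval y f ≠ 0) : StableAt f y := by
  intro x hx
  have hI : aeval (Complex.I • toComplex y + toComplex x) f = 0 := by rw [add_comm]; exact hx
  have hy0 : aeval (toComplex y) f ≠ 0 := by
    rw [aeval_toComplex]; exact_mod_cast hy
  have hev := eventually_exists_root_near hf hd (continuous_toComplex.tendsto y)
    (tendsto_const_nhds (x := toComplex x)) hI hy0 one_pos
  obtain ⟨y', ⟨t, ht, h0⟩, hy'⟩ := (mem_closure_iff_frequently.1 h).and_eventually hev |>.exists
    |>.imp fun _ h => h.symm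
  have him := StableAt.im_eq_zero hf hy' h0
  have := (Complex.abs_im_le_norm (Complex.I - t)).trans_lt ht
  rw [Complex.sub_im, Complex.I_im, him] at this
  simp at this

/-- Gårding: a hyperbolic polynomial is hyperbolic with respect to every point of its
hyperbolicity cone. -/
theorem StableAt.of_mem_hyperbolicityCone (hf : f.IsHomogeneous d) (hd : d ≠ 0)
    {e a : Fin n → ℝ} (h : StableAt f e) (ha : a ∈ hyperbolicityCone f e) : StableAt f a := by
  -- The stable directions form an open set, relatively closed where `f ≠ 0`, so they contain the
  -- whole component of `e`.
  refine isPreconnected_connectedComponentIn.subset_of_closure_inter_subset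
    (u := {y | StableAt f y}) (isOpen_iff_mem_nhds.2 fun y hy => StableAt.eventually hf hd hy)
    ⟨e, mem_connectedComponentIn (h.eval_ne_zero hf), h⟩ ?_ ha
  rintro y ⟨hy, hy'⟩
  exact StableAt.of_mem_closure hf hd hy (connectedComponentIn_subset _ _ hy')

end ComplexPoints

/-! ### Directional derivatives at real zeros and their sign on the cone. -/

section Gradient

open MvPolynomial Filter Topology

variable {n d : ℕ} {f : MvPolynomial (Fin n) ℝ}

theorem eval_dirDeriv (b x : Fin n → ℝ) (f : MvPolynomial (Fin n) ℝ) :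
    eval x (dirDeriv b f) = ∑ i, b i * eval x (pderiv i f) := by
  simp [dirDeriv]

/-- At a real zero of `f`, a vanishing derivative in a direction of stability forces the gradient
to vanish. -/
theorem StableAt.eval_dirDeriv_eq_zero (hf : f.IsHomogeneous d) (hd : d ≠ 0) {a x : Fin n → ℝ}
    (h : StableAt f a) (hx : eval x f = 0) (hax : eval x (dirDeriv a f) = 0) (b : Fin n → ℝ) :
    eval x (dirDeriv b f) = 0 := by
  by_contra hb
  obtain ⟨ε, hε, hball⟩ := Metric.eventually_nhds_iff_ball.1 (h.eventually hf hd)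
  -- Both hypotheses at `x` say that `f(t a + x)` has a double zero at `t = 0`, so `f(x + iη a) =
  -- O(η²)`.
  obtain ⟨r, hr⟩ : Polynomial.X ^ 2 ∣ linePoly (toComplex a) (toComplex x) f := by
    rw [Polynomial.X_pow_dvd_iff]
    intro k hk
    interval_cases k
    · rw [Polynomial.coeff_zero_eq_eval_zero, eval_linePoly, zero_smul, zero_add,
        aeval_toComplex, hx, Complex.ofReal_zero]
    · have h1 : (Polynomial.derivative (linePoly (toComplex a) (toComplex x) f)).eval 0 = 0 := by
        refine (congrArg (Polynomial.eval 0) (derivative_linePoly a (toComplex x) f)).trans ?_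
        rw [eval_linePoly, zero_smul, zero_add, aeval_toComplex, hax, Complex.ofReal_zero]
      rw [← Polynomial.coeff_zero_eq_eval_zero, Polynomial.coeff_derivative] at h1
      simpa using h1
  set v : ℝ → Fin n → ℂ := fun η => ((η : ℂ) * Complex.I) • toComplex a + toComplex x with hv
  have hvc : Continuous v := by fun_prop
  have hv0 : v 0 = toComplex x := by simp [hv]
  have hval : ∀ η, aeval (v η) f = ((η : ℂ) * Complex.I) ^ 2 * r.eval ((η : ℂ) * Complex.I) := by
    intro η
    rw [← eval_linePoly, hr]
    simp
  have hL : Tendsto (fun η : ℝ => d * |η| * ‖r.eval ((η : ℂ) * Complex.I)‖ * ‖b‖) (𝓝[>] 0)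
      (𝓝 0) := by
    have hc : Continuous fun η : ℝ => d * |η| * ‖r.eval ((η : ℂ) * Complex.I)‖ * ‖b‖ := by
      fun_prop
    have := (hc.tendsto 0).mono_left (nhdsWithin_le_nhds (s := Set.Ioi 0))
    simpa using this
  have hR : Tendsto (fun η : ℝ => ε * ‖aeval (v η) (dirDeriv b f)‖) (𝓝[>] 0)
      (𝓝 (ε * ‖((eval x (dirDeriv b f) : ℝ) : ℂ)‖)) := by
    have hc : Continuous fun η : ℝ => ε * ‖aeval (v η) (dirDeriv b f)‖ :=
      continuous_const.mul ((continuous_aeval_point _).comp hvc).norm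
    have := (hc.tendsto 0).mono_left (nhdsWithin_le_nhds (s := Set.Ioi 0))
    rwa [hv0, aeval_toComplex] at this
  have hpos : 0 < ε * ‖((eval x (dirDeriv b f) : ℝ) : ℂ)‖ :=
    mul_pos hε (norm_pos_iff.2 (by exact_mod_cast hb))
  obtain ⟨η, hη, hη0⟩ := ((hL.eventually_lt hR hpos).and self_mem_nhdsWithin).exists
  have hη0 : 0 < η := hη0
  have hder : (Polynomial.derivative (linePoly (toComplex b) (v η) f)).eval 0 =
      aeval (v η) (dirDeriv b f) := by
    refine (congrArg (Polynomial.eval 0) (derivative_linePoly b (v η) f)).trans ?_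
    rw [eval_linePoly, zero_smul, zero_add]
  have hne : 0 < ‖aeval (v η) (dirDeriv b f)‖ := by
    by_contra hcon
    have h0 : ‖aeval (v η) (dirDeriv b f)‖ = 0 := le_antisymm (not_lt.1 hcon) (norm_nonneg _)
    rw [h0, mul_zero] at hη
    exact absurd hη (not_lt.2 (by positivity))
  -- As `D_b f` stays away from `0`, some zero `w b + x + iη a` has `w = O(η²)`. Its imaginary part
  -- is `η (a + (Im w / η) b)`, a multiple of a direction close to `a`, hence stable: a
  -- contradiction.
  obtain ⟨w, hw, hle⟩ := exists_root_norm_mul_le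
    (natDegree_linePoly_le_and_coeff hf (toComplex b) (v η)).1
    (by rw [hder]; exact norm_pos_iff.1 hne)
  rw [hder, eval_linePoly, zero_smul, zero_add, hval, norm_mul, norm_pow, norm_mul,
    Complex.norm_I, mul_one, Complex.norm_real, Real.norm_eq_abs, abs_of_pos hη0] at hle
  rw [abs_of_pos hη0] at hη
  rw [eval_linePoly] at hw
  have hsmall : ‖w‖ * ‖b‖ < η * ε := by
    refine lt_of_mul_lt_mul_right ?_ hne.le
    calc ‖w‖ * ‖b‖ * ‖aeval (v η) (dirDeriv b f)‖
        = ‖w‖ * ‖aeval (v η) (dirDeriv b f)‖ * ‖b‖ := by ring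
      _ ≤ d * (η ^ 2 * ‖r.eval ((η : ℂ) * Complex.I)‖) * ‖b‖ := by gcongr
      _ = η * (d * η * ‖r.eval ((η : ℂ) * Complex.I)‖ * ‖b‖) := by ring
      _ < η * (ε * ‖aeval (v η) (dirDeriv b f)‖) := by gcongr
      _ = η * ε * ‖aeval (v η) (dirDeriv b f)‖ := by ring
  have hmem : a + (w.im / η) • b ∈ Metric.ball a ε := by
    rw [mem_ball_iff_norm, add_sub_cancel_left, norm_smul, norm_div, Real.norm_eq_abs,
      Real.norm_eq_abs, abs_of_pos hη0, div_mul_eq_mul_div, div_lt_iff₀ hη0, mul_comm ε]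
    exact (mul_le_mul_of_nonneg_right (Complex.abs_im_le_norm w) (norm_nonneg b)).trans_lt hsmall
  refine (hball _ hmem).smul hf hη0.ne' (w.re • b + x) ?_
  rw [← hw]
  congr 2
  have hηb : η • (a + (w.im / η) • b) = η • a + w.im • b := by
    rw [smul_add, smul_smul, mul_div_cancel₀ _ hη0.ne']
  simp only [hηb, hv]
  simp only [toComplex_add, toComplex_smul]
  nth_rewrite 3 [← Complex.re_add_im w]
  module

theorem mul_pos_of_isPreconnected {X : Type*} [TopologicalSpace X] {s : Set X}
    (hs : IsPreconnected s) {g : X → ℝ} (hg : ContinuousOn g s) (h0 : ∀ x ∈ s, g x ≠ 0) {x y : X}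
    (hx : x ∈ s) (hy : y ∈ s) : 0 < g x * g y := by
  by_contra hcon
  have hne := mul_ne_zero (h0 x hx) (h0 y hy)
  rcases mul_neg_iff.1 (lt_of_le_of_ne (not_lt.1 hcon) hne) with ⟨h1, h2⟩ | ⟨h1, h2⟩
  · obtain ⟨z, hz, hz0⟩ := hs.intermediate_value hy hx hg ⟨h2.le, h1.le⟩
    exact h0 z hz hz0
  · obtain ⟨z, hz, hz0⟩ := hs.intermediate_value hx hy hg ⟨h1.le, h2.le⟩
    exact h0 z hz hz0

theorem eval_pos_of_mem_hyperbolicityCone {e a : Fin n → ℝ}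
    (he : 0 < eval e f) (ha : a ∈ hyperbolicityCone f e) : 0 < eval a f :=
  (pos_iff_pos_of_mul_pos (mul_pos_of_isPreconnected
    (isPreconnected_connectedComponentIn (x := e) (F := {x | eval x f ≠ 0}))
    (MvPolynomial.continuous_eval f).continuousOn
    (fun _ hx => connectedComponentIn_subset _ _ hx) (mem_connectedComponentIn he.ne') ha)).1 he

/-- The sign condition on the real zeros of `f` does not depend on the chosen direction in the
hyperbolicity cone. -/
theorem StableAt.derivative_mul_nonneg (hf : f.IsHomogeneous d) (hd : d ≠ 0) {e a : Fin n → ℝ}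
    (h : StableAt f e) (ha : a ∈ hyperbolicityCone f e) {x : Fin n → ℝ} (hx : eval x f = 0)
    {c : ℝ} (hc : 0 ≤ eval x (dirDeriv e f) * c) : 0 ≤ eval x (dirDeriv a f) * c := by
  by_cases h0 : eval x (dirDeriv e f) = 0
  · rw [h.eval_dirDeriv_eq_zero hf hd hx h0 a, zero_mul]
  have hpos : 0 < eval x (dirDeriv e f) * eval x (dirDeriv a f) := by
    refine mul_pos_of_isPreconnected (g := fun b => eval x (dirDeriv b f))
      (isPreconnected_connectedComponentIn (x := e) (F := {x | eval x f ≠ 0})) ?_ ?_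
      (mem_connectedComponentIn (h.eval_ne_zero hf)) ha
    · simp only [eval_dirDeriv]
      fun_prop
    -- Every `b` in the cone is stable, so `D_b f(x) = 0` would kill the gradient and with it `D_e
    -- f(x)`.
    · intro b hb hb0
      exact h0 ((h.of_mem_hyperbolicityCone hf hd hb).eval_dirDeriv_eq_zero hf hd hx hb0 e)
  refine nonneg_of_mul_nonneg_right (a := eval x (dirDeriv e f) ^ 2) ?_ (by positivity)
  nlinarith [mul_nonneg hpos.le hc]

end Gradient

/-! ### Square-freeness and simple zeros on generic lines. -/

section Generic

open MvPolynomial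

variable {n d : ℕ}

/-- The substitution `x ↦ x + T c` on polynomials over `ℝ[x]`. -/
noncomputable def shiftHom (c : Fin n → ℝ) :
    Polynomial (MvPolynomial (Fin n) ℝ) →+* Polynomial (MvPolynomial (Fin n) ℝ) :=
  Polynomial.eval₂RingHom (aeval fun i => Polynomial.X *
    Polynomial.C (algebraMap ℝ (MvPolynomial (Fin n) ℝ) (c i)) + Polynomial.C (X i) :
      MvPolynomial (Fin n) ℝ →ₐ[ℝ] Polynomial (MvPolynomial (Fin n) ℝ)).toRingHom Polynomial.X

theorem shiftHom_C (c : Fin n → ℝ) (f : MvPolynomial (Fin n) ℝ) :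
    shiftHom c (Polynomial.C f) =
      linePoly (algebraMap ℝ (MvPolynomial (Fin n) ℝ) ∘ c) X f := by
  simp [shiftHom, linePoly]

theorem shiftHom_neg_comp (c : Fin n → ℝ) : (shiftHom (-c)).comp (shiftHom c) = RingHom.id _ := by
  refine Polynomial.ringHom_ext' ?_ ?_
  · refine MvPolynomial.ringHom_ext (fun r => ?_) fun i => ?_
    · simp [shiftHom, Polynomial.algebraMap_apply]
    · simp only [shiftHom, RingHom.comp_apply]
      simp
      ring
  · simp [shiftHom]

theorem squarefree_C {R : Type*} [CommRing R] [IsDomain R] {r : R} (hr : Squarefree r) :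
    Squarefree (Polynomial.C r) := by
  rintro p ⟨q, hq⟩
  have hdeg : p.natDegree = 0 := by
    have h0 : Polynomial.C r ≠ 0 := Polynomial.C_ne_zero.2 hr.ne_zero
    rw [hq] at h0
    have h1 := congrArg Polynomial.natDegree hq
    rw [Polynomial.natDegree_C, Polynomial.natDegree_mul (left_ne_zero_of_mul h0)
      (right_ne_zero_of_mul h0), Polynomial.natDegree_mul
      (left_ne_zero_of_mul (left_ne_zero_of_mul h0))
      (left_ne_zero_of_mul (left_ne_zero_of_mul h0))] at h1
    omega
  obtain ⟨s, rfl⟩ := Polynomial.natDegree_eq_zero.1 hdeg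
  refine Polynomial.isUnit_C.2 (hr s ⟨q.coeff 0, ?_⟩)
  have := congrArg (fun p => Polynomial.coeff p 0) hq
  simpa [mul_assoc] using this

/-- `f(x + T e)` is the image of the constant `f` under the automorphism `shiftHom e`, whose inverse
is `shiftHom (-e)`. -/
theorem squarefree_linePoly_X {f : MvPolynomial (Fin n) ℝ} (hf : Squarefree f) (e : Fin n → ℝ) :
    Squarefree (linePoly (algebraMap ℝ (MvPolynomial (Fin n) ℝ) ∘ e) X f) := by
  intro p hp
  have h1 : ∀ p, shiftHom (-e) (shiftHom e p) = p := fun p =>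
    RingHom.congr_fun (shiftHom_neg_comp e) p
  have h2 : ∀ p, shiftHom e (shiftHom (-e) p) = p := fun p => by
    have := RingHom.congr_fun (shiftHom_neg_comp (-e)) p
    rwa [neg_neg] at this
  have h3 := map_dvd (shiftHom (-e)) hp
  rw [← shiftHom_C, h1, map_mul] at h3
  have h4 := (squarefree_C hf _ h3).map (shiftHom e)
  rwa [h2] at h4

/-- Gauss's lemma for squarefree monic polynomials. -/
theorem squarefree_map_of_monic {R : Type*} (K : Type*) [CommRing R] [IsDomain R]
    [IsIntegrallyClosed R] [Field K] [Algebra R K] [IsFractionRing R K] {p : Polynomial R}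
    (hp : p.Monic) (hs : Squarefree p) : Squarefree (p.map (algebraMap R K)) := by
  intro q hq
  have hinj := IsFractionRing.injective R K
  have hp0 : p.map (algebraMap R K) ≠ 0 := (hp.map _).ne_zero
  have hq0 : q ≠ 0 := by rintro rfl; simp [hp0] at hq
  obtain ⟨q', hq'⟩ := IsIntegrallyClosed.eq_map_mul_C_of_dvd K hp ((dvd_mul_right q q).trans hq)
  have hlc : q.leadingCoeff ≠ 0 := Polynomial.leadingCoeff_ne_zero.2 hq0
  have hmonic : q'.Monic := by
    have h1 := congrArg Polynomial.leadingCoeff hq'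
    rw [Polynomial.leadingCoeff_mul, Polynomial.leadingCoeff_C,
      mul_eq_right₀ hlc, Polynomial.leadingCoeff_map_of_injective hinj] at h1
    exact hinj (by rw [h1, map_one])
  have hdvd : (q' * q').map (algebraMap R K) ∣ p.map (algebraMap R K) := by
    refine dvd_trans ?_ hq
    rw [Polynomial.map_mul]
    exact mul_dvd_mul ⟨_, hq'.symm⟩ ⟨_, hq'.symm⟩
  have hunit := hs q' ((hp.dvd_iff_fraction_map_dvd_fraction_map (hmonic.mul hmonic)).1 hdvd)
  rw [← hq']
  exact (hunit.map (Polynomial.mapRingHom (algebraMap R K))).mul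
    (Polynomial.isUnit_C.2 (isUnit_iff_ne_zero.2 hlc))

/-- A squarefree monic polynomial over an integrally closed domain of characteristic zero has a
nonzero combination with its derivative that is constant. -/
theorem exists_mul_add_mul_derivative_eq_C {R : Type*} [CommRing R] [IsDomain R] [CharZero R]
    [IsIntegrallyClosed R] {p : Polynomial R} (hp : p.Monic) (hs : Squarefree p) :
    ∃ (r : R) (u v : Polynomial R), r ≠ 0 ∧
      u * p + v * Polynomial.derivative p = Polynomial.C r := by
  let K := FractionRing R
  have hinj := IsFractionRing.injective R K
  -- In characteristic zero square-free means separable over the fraction field; clearing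
  -- denominators in the Bézout identity gives `r`.
  have hsep := PerfectField.separable_iff_squarefree.2 (squarefree_map_of_monic K hp hs)
  obtain ⟨u, v, huv⟩ := hsep
  obtain ⟨b, hb, hbu⟩ := IsLocalization.integerNormalization_spec (nonZeroDivisors R) u
  obtain ⟨c, hc, hcv⟩ := IsLocalization.integerNormalization_spec (nonZeroDivisors R) v
  refine ⟨b * c, Polynomial.C c * IsLocalization.integerNormalization (nonZeroDivisors R) u,
    Polynomial.C b * IsLocalization.integerNormalization (nonZeroDivisors R) v,
    mul_ne_zero (nonZeroDivisors.ne_zero hb) (nonZeroDivisors.ne_zero hc), ?_⟩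
  apply Polynomial.map_injective _ hinj
  have hsm : ∀ (r : R) (w : Polynomial K), r • w = Polynomial.C (algebraMap R K r) * w := by
    intro r w
    rw [← Polynomial.smul_eq_C_mul, algebraMap_smul]
  rw [hsm] at hbu hcv
  simp only [Polynomial.map_add, Polynomial.map_mul, Polynomial.map_C, hbu, hcv, map_mul,
    ← Polynomial.derivative_map]
  linear_combination (Polynomial.C (algebraMap R K b) * Polynomial.C (algebraMap R K c)) * huv

/-- On a generic line in direction `e`, a squarefree polynomial has only simple zeros. -/
theorem exists_ne_zero_isCoprime {f : MvPolynomial (Fin n) ℝ} (hf : f.IsHomogeneous d)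
    (hs : Squarefree f) {e : Fin n → ℝ} (he : eval e f ≠ 0) :
    ∃ D : MvPolynomial (Fin n) ℝ, D ≠ 0 ∧ ∀ a, eval a D ≠ 0 →
      IsCoprime (lineRestrict f e a) (Polynomial.derivative (lineRestrict f e a)) := by
  set F := linePoly (algebraMap ℝ (MvPolynomial (Fin n) ℝ) ∘ e) X f with hF
  have hev : aeval (algebraMap ℝ (MvPolynomial (Fin n) ℝ) ∘ e) f =
      algebraMap ℝ (MvPolynomial (Fin n) ℝ) (eval e f) :=
    MvPolynomial.aeval_algebraMap_apply _ _ _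
  have hlc : F.leadingCoeff = algebraMap ℝ (MvPolynomial (Fin n) ℝ) (eval e f) := by
    rw [hF, leadingCoeff_linePoly hf (by rw [hev]; simpa using he), hev]
  have hunit : IsUnit (Polynomial.C (algebraMap ℝ (MvPolynomial (Fin n) ℝ) (eval e f)⁻¹)) :=
    Polynomial.isUnit_C.2 ((isUnit_iff_ne_zero.2 (inv_ne_zero he)).map _)
  have hmonic : (F * Polynomial.C (algebraMap ℝ (MvPolynomial (Fin n) ℝ) (eval e f)⁻¹)).Monic := by
    rw [Polynomial.Monic, Polynomial.leadingCoeff_mul, hlc, Polynomial.leadingCoeff_C, ← map_mul,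
      mul_inv_cancel₀ he, map_one]
  have hsq : Squarefree (F * Polynomial.C (algebraMap ℝ (MvPolynomial (Fin n) ℝ)
      (eval e f)⁻¹)) := by
    intro p hp
    exact squarefree_linePoly_X hs e p (hunit.dvd_mul_right.1 hp)
  -- `D` plays the role of a discriminant: where `D(a) ≠ 0`, the identity specializes at `x = a` to
  -- coprimality.
  obtain ⟨D, u, v, hD, huv⟩ := exists_mul_add_mul_derivative_eq_C hmonic hsq
  refine ⟨D, hD, fun a ha => ?_⟩
  have hmap : F.map (eval a) = lineRestrict f e a := by
    have h := map_linePoly (aeval a : MvPolynomial (Fin n) ℝ →ₐ[ℝ] ℝ)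
      (algebraMap ℝ (MvPolynomial (Fin n) ℝ) ∘ e) X f
    rw [lineRestrict_eq_linePoly]
    refine h.trans ?_
    congr 1 <;> ext i <;> simp
  have h := congrArg (Polynomial.map (eval a)) huv
  simp only [Polynomial.map_add, Polynomial.map_mul, Polynomial.map_C, Polynomial.derivative_mul,
    Polynomial.derivative_C, mul_zero, add_zero, hmap, ← Polynomial.derivative_map] at h
  refine ⟨Polynomial.C (eval a D)⁻¹ * (u.map (eval a) * Polynomial.C (eval a
      (algebraMap ℝ (MvPolynomial (Fin n) ℝ) (eval e f)⁻¹))),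
    Polynomial.C (eval a D)⁻¹ * (v.map (eval a) * Polynomial.C (eval a
      (algebraMap ℝ (MvPolynomial (Fin n) ℝ) (eval e f)⁻¹))), ?_⟩
  have hinv : Polynomial.C (eval a D)⁻¹ * Polynomial.C (eval a D) = 1 := by
    rw [← Polynomial.C_mul, inv_mul_cancel₀ ha, Polynomial.C_1]
  linear_combination Polynomial.C (eval a D)⁻¹ * h + hinv

/-- The complement of the zero set of a nonzero polynomial is dense. -/
theorem dense_eval_ne_zero {D : MvPolynomial (Fin n) ℝ} (hD : D ≠ 0) :
    Dense {a | eval a D ≠ 0} := by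
  obtain ⟨b, hb⟩ : ∃ b, eval b D ≠ 0 := by
    by_contra hcon
    push Not at hcon
    exact hD (MvPolynomial.funext fun x => by simpa using hcon x)
  intro a
  set p := lineRestrict D (b - a) a with hp
  have heval : ∀ t, p.eval t = eval (t • (b - a) + a) D := fun t => eval_linePoly _ _ _ _
  have hp0 : p ≠ 0 := by
    intro h0
    have := heval 1
    rw [h0, one_smul, sub_add_cancel] at this
    exact hb (by simpa using this.symm)
  have hd : Dense {t | p.eval t ≠ 0} := by
    have h1 : {t | p.eval t ≠ 0} = (p.roots.toFinset : Set ℝ)ᶜ := by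
      ext t; simp [hp0]
    rw [h1]
    exact p.roots.toFinset.countable_toSet.dense_compl ℝ
  have hc : Continuous fun t : ℝ => t • (b - a) + a := by fun_prop
  have h2 := hc.range_subset_closure_image_dense hd (Set.mem_range_self 0)
  simp only [zero_smul, zero_add] at h2
  refine closure_mono ?_ h2
  rintro _ ⟨t, ht, rfl⟩
  rwa [Set.mem_ofPred_eq, heval] at ht

end Generic

/-! ### From the sign condition to interlacing, and back. -/

section Main

open MvPolynomial Filter Topology Lagrange

variable {n d k : ℕ} {f h : MvPolynomial (Fin n) ℝ} {e : Fin n → ℝ}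

theorem eval_lineRestrict (f : MvPolynomial (Fin n) ℝ) (e a : Fin n → ℝ) (t : ℝ) :
    (lineRestrict f e a).eval t = eval (t • e + a) f :=
  eval_linePoly e a f t

theorem derivative_lineRestrict (f : MvPolynomial (Fin n) ℝ) (e a : Fin n → ℝ) :
    Polynomial.derivative (lineRestrict f e a) = lineRestrict (dirDeriv e f) e a :=
  derivative_linePoly e a f

theorem leadingCoeff_lineRestrict (hf : f.IsHomogeneous d) (he : eval e f ≠ 0) (a : Fin n → ℝ) :
    (lineRestrict f e a).leadingCoeff = eval e f :=
  leadingCoeff_linePoly hf he a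

theorem eval_lineRestrict_zero (f : MvPolynomial (Fin n) ℝ) (e a : Fin n → ℝ) :
    (lineRestrict f e a).eval 0 = eval a f := by
  rw [eval_lineRestrict, zero_smul, zero_add]

theorem natDegree_lineRestrict_le_and_coeff (hf : f.IsHomogeneous d) (e a : Fin n → ℝ) :
    (lineRestrict f e a).natDegree ≤ d ∧ (lineRestrict f e a).coeff d = eval e f :=
  natDegree_linePoly_le_and_coeff hf e a

theorem StableAt.lineRestrict_eq_nodal (hf : f.IsHomogeneous d) (h : StableAt f e) {a : Fin n → ℝ}
    (hc : IsCoprime (lineRestrict f e a) (Polynomial.derivative (lineRestrict f e a))) :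
    ∃ α : Fin d → ℝ, StrictMono α ∧
      lineRestrict f e a = Polynomial.C (eval e f) * nodal Finset.univ α := by
  have hfe := h.eval_ne_zero hf
  have hdeg : (lineRestrict f e a).natDegree = d := natDegree_linePoly hf hfe a
  obtain ⟨α, hα, hp⟩ := (((stableAt_iff hf).1 h).2 a).exists_strictMono_of_isCoprime hdeg hc
  exact ⟨α, hα, by rwa [leadingCoeff_lineRestrict hf hfe] at hp⟩

theorem eval_derivative_nodal_of_lineRestrict_eq {a : Fin n → ℝ} {α : Fin d → ℝ}
    (hp : lineRestrict f e a = Polynomial.C (eval e f) * nodal Finset.univ α) (t : ℝ) :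
    eval (t • e + a) (dirDeriv e f) =
      eval e f * (Polynomial.derivative (nodal Finset.univ α)).eval t := by
  rw [← eval_lineRestrict, ← derivative_lineRestrict, hp, Polynomial.derivative_C_mul,
    Polynomial.eval_mul, Polynomial.eval_C]

theorem eval_eq_zero_of_lineRestrict_eq {a : Fin n → ℝ} {α : Fin d → ℝ}
    (hp : lineRestrict f e a = Polynomial.C (eval e f) * nodal Finset.univ α) (i : Fin d) :
    eval (α i • e + a) f = 0 := by
  rw [← eval_lineRestrict, hp, Polynomial.eval_mul, eval_nodal_at_node (Finset.mem_univ i),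
    mul_zero]

/-- `h(e)` is the coefficient of `t ^ k` in `h(t e + a)`, which interpolation at the zeros of `f`
shows to be positive. -/
theorem eval_direction_pos (hf : f.IsHomogeneous (k + 1)) (hs : Squarefree f) (he : StableAt f e)
    (hpos : 0 < eval e f) (hh : h.IsHomogeneous k) (hh0 : h ≠ 0)
    (hnn : ∀ x, eval x f = 0 → 0 ≤ eval x (dirDeriv e f * h)) : 0 < eval e h := by
  obtain ⟨D, hD, hcop⟩ := exists_ne_zero_isCoprime hf hs hpos.ne'
  -- On this line `f` has simple zeros and `h` is not identically zero.
  obtain ⟨a, ha⟩ := (dense_eval_ne_zero (mul_ne_zero hD hh0)).nonempty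
  rw [Set.mem_ofPred_eq, map_mul] at ha
  obtain ⟨α, hα, hp⟩ := he.lineRestrict_eq_nodal hf (hcop a (left_ne_zero_of_mul ha))
  obtain ⟨hdeg, hcoeff⟩ := natDegree_lineRestrict_le_and_coeff hh e a
  rw [← hcoeff]
  refine coeff_pos_of_derivative_mul_nonneg hα hdeg ?_ fun i => ?_
  · intro h0
    have := eval_lineRestrict_zero h e a
    rw [h0, Polynomial.eval_zero] at this
    exact right_ne_zero_of_mul ha this.symm
  · have h1 := hnn _ (eval_eq_zero_of_lineRestrict_eq hp i)
    rw [map_mul, eval_derivative_nodal_of_lineRestrict_eq hp, mul_assoc] at h1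
    rw [eval_lineRestrict]
    exact nonneg_of_mul_nonneg_right h1 hpos

/-- At a simple zero of `f` on the line, `D_e f * (h + ε D_e f) ≥ ε (D_e f)² > 0`. The perturbation
makes the sign condition strict even where `h` vanishes. -/
theorem exists_nested_of_isCoprime (hf : f.IsHomogeneous (k + 1)) (he : StableAt f e)
    (hpos : 0 < eval e f) (hh : h.IsHomogeneous k)
    (hnn : ∀ x, eval x f = 0 → 0 ≤ eval x (dirDeriv e f * h)) {ε : ℝ} (hε : 0 < ε)
    {a : Fin n → ℝ}
    (hc : IsCoprime (lineRestrict f e a) (Polynomial.derivative (lineRestrict f e a))) :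
    ∃ (α : Fin (k + 1) → ℝ) (β : Fin k → ℝ), Nested α β ∧
      lineRestrict f e a = Polynomial.C (eval e f) * nodal Finset.univ α ∧
      lineRestrict (h + C ε * dirDeriv e f) e a =
        Polynomial.C (eval e (h + C ε * dirDeriv e f)) * nodal Finset.univ β := by
  obtain ⟨α, hα, hp⟩ := he.lineRestrict_eq_nodal hf hc
  have hhom : (h + C ε * dirDeriv e f).IsHomogeneous k :=
    hh.add ((dirDeriv_isHomogeneous hf e).C_mul ε)
  obtain ⟨hdeg, hcoeff⟩ := natDegree_lineRestrict_le_and_coeff hhom e a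
  have hsign : ∀ i, 0 < (Polynomial.derivative (nodal Finset.univ α)).eval (α i) *
      (lineRestrict (h + C ε * dirDeriv e f) e a).eval (α i) := by
    intro i
    have h1 := hnn _ (eval_eq_zero_of_lineRestrict_eq hp i)
    have hne : eval (α i • e + a) (dirDeriv e f) ≠ 0 := by
      intro h0
      obtain ⟨u, v, huv⟩ := hc
      have h2 := congrArg (Polynomial.eval (α i)) huv
      rw [Polynomial.eval_add, Polynomial.eval_mul, Polynomial.eval_mul, derivative_lineRestrict,
        eval_lineRestrict, eval_lineRestrict, h0, eval_eq_zero_of_lineRestrict_eq hp i] at h2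
      simp at h2
    refine pos_of_mul_pos_right (a := eval e f) ?_ hpos.le
    rw [← mul_assoc, ← eval_derivative_nodal_of_lineRestrict_eq hp, eval_lineRestrict]
    simp only [map_add, map_mul, eval_C] at h1 ⊢
    have h3 : 0 < eval (α i • e + a) (dirDeriv e f) ^ 2 := by positivity
    nlinarith [mul_pos hε h3]
  obtain ⟨β, hβ, hq⟩ := exists_nested_of_derivative_mul_pos hα hdeg hsign
  exact ⟨α, β, hβ, hp, by rwa [hcoeff] at hq⟩

theorem univInterlaces_of_nonneg (hf : f.IsHomogeneous (k + 1)) (hs : Squarefree f)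
    (he : StableAt f e) (hpos : 0 < eval e f) (hh : h.IsHomogeneous k) (hh0 : h ≠ 0)
    (hnn : ∀ x, eval x f = 0 → 0 ≤ eval x (dirDeriv e f * h)) (a : Fin n → ℝ) :
    UnivInterlaces (lineRestrict h e a) (lineRestrict f e a) := by
  have hhe := eval_direction_pos hf hs he hpos hh hh0 hnn
  obtain ⟨D, hD, hcop⟩ := exists_ne_zero_isCoprime hf hs hpos.ne'
  obtain ⟨v, hv, hlim⟩ := mem_closure_iff_seq_limit.1 (dense_eval_ne_zero hD a)
  -- Generic lines `v m → a` and perturbations `ε → 0` are taken along the same sequence.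
  have hdata := fun m : ℕ => exists_nested_of_isCoprime hf he hpos hh hnn
    (ε := 1 / ((m : ℝ) + 1)) (by positivity) (hcop (v m) (hv m))
  choose α β hn hp hq using hdata
  obtain ⟨M, hM0, hM⟩ := exists_root_bound (𝕜 := ℝ) hf (u := e) hpos.ne'
  obtain ⟨B, hB⟩ := hlim.norm.bddAbove_range
  have hε : Tendsto (fun m : ℕ => 1 / ((m : ℝ) + 1)) atTop (𝓝 0) :=
    tendsto_one_div_add_atTop_nhds_zero_nat
  have hpt : ∀ t : ℝ, Tendsto (fun m => t • e + v m) atTop (𝓝 (t • e + a)) :=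
    fun t => hlim.const_add _
  have hbd : ∀ m i, |α m i| ≤ M * B := fun m i =>
    (hM _ _ (eval_eq_zero_of_lineRestrict_eq (hp m) i)).trans
      (mul_le_mul_of_nonneg_left (hB (Set.mem_range_self m)) hM0)
  have hlimf : ∀ t, Tendsto (fun m => (lineRestrict f e (v m)).eval t) atTop
      (𝓝 ((lineRestrict f e a).eval t)) := by
    intro t
    simp only [eval_lineRestrict]
    exact ((MvPolynomial.continuous_eval f).tendsto _).comp (hpt t)
  have hlimh : ∀ t, Tendsto (fun m : ℕ =>
      (lineRestrict (h + C (1 / ((m : ℝ) + 1)) * dirDeriv e f) e (v m)).eval t) atTop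
      (𝓝 ((lineRestrict h e a).eval t)) := by
    intro t
    simp only [eval_lineRestrict, map_add, map_mul, eval_C]
    simpa using (((MvPolynomial.continuous_eval h).tendsto _).comp (hpt t)).add
      (hε.mul (((MvPolynomial.continuous_eval (dirDeriv e f)).tendsto _).comp (hpt t)))
  have hlimc : Tendsto (fun m : ℕ => eval e (h + C (1 / ((m : ℝ) + 1)) * dirDeriv e f)) atTop
      (𝓝 (eval e h)) := by
    simp only [map_add, map_mul, eval_C]
    simpa using (hε.mul_const (eval e (dirDeriv e f))).const_add (eval e h)
  obtain ⟨x, y, hxy, hx, hy⟩ := exists_nested_of_tendsto hn hbd hp hq hlimf hlimh hlimc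
  rw [hx, hy]
  exact hxy.univInterlaces hpos.ne' hhe.ne'

theorem StableAt.isHyperbolic (hf : f.IsHomogeneous d) (h : StableAt f e) : IsHyperbolic f e := by
  have h1 := (stableAt_iff hf).1 h
  have hf0 : f ≠ 0 := by rintro rfl; simp at h1
  exact ⟨by rwa [hf.totalDegree hf0], h1⟩

theorem mem_interlacerSet_of_nonneg (hf : f.IsHomogeneous (k + 1)) (hs : Squarefree f)
    (he : StableAt f e) (hpos : 0 < eval e f) (hh : h.IsHomogeneous k) (hh0 : h ≠ 0)
    (hnn : ∀ x, eval x f = 0 → 0 ≤ eval x (dirDeriv e f * h)) : h ∈ interlacerSet f e :=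
  ⟨⟨he.isHyperbolic hf, ⟨k, (hf.totalDegree hs.ne_zero).symm, hh⟩,
    univInterlaces_of_nonneg hf hs he hpos hh hh0 hnn⟩,
    eval_direction_pos hf hs he hpos hh hh0 hnn⟩

theorem wronskian_nonneg_of_mem_interlacerSet (hf : f.IsHomogeneous (k + 1))
    (hpos : 0 < eval e f) (hh : h.IsHomogeneous k) (hmem : h ∈ interlacerSet f e)
    (x : Fin n → ℝ) : 0 ≤ eval x (dirDeriv e f * h - f * dirDeriv e h) := by
  obtain ⟨⟨-, -, hi⟩, hhe⟩ := hmem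
  -- The line `t e + x` passes through `x` at `t = 0`.
  have h1 := (hi x).wronskian_nonneg
    (by rw [leadingCoeff_lineRestrict hf hpos.ne']; exact hpos.le)
    (by rw [leadingCoeff_lineRestrict hh hhe.ne']; exact hhe.le) 0
  simpa only [derivative_lineRestrict, eval_lineRestrict_zero, map_sub, map_mul] using h1

end Main

end HyperbolicInterlacers

theorem theorem2p1 {n d : ℕ} (hd : 1 ≤ d) (f h : MvPolynomial (Fin n) ℝ) (e : Fin n → ℝ)
    (hfd : f.IsHomogeneous d) (hfsq : Squarefree f)
    (hfe : HyperbolicInterlacers.IsHyperbolic f e) (hfpos : 0 < MvPolynomial.eval e f)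
    (hhd : h.IsHomogeneous (d - 1)) (hh0 : h ≠ 0) :
    List.TFAE [
      h ∈ HyperbolicInterlacers.interlacerSet f e,
      ∀ a ∈ HyperbolicInterlacers.hyperbolicityCone f e,
        h ∈ HyperbolicInterlacers.interlacerSet f a,
      ∀ x : Fin n → ℝ, MvPolynomial.eval x f = 0 →
        0 ≤ MvPolynomial.eval x (HyperbolicInterlacers.dirDeriv e f * h),
      ∀ x : Fin n → ℝ,
        0 ≤ MvPolynomial.eval x (HyperbolicInterlacers.dirDeriv e f * h -
          f * HyperbolicInterlacers.dirDeriv e h)] := by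
  obtain ⟨k, rfl⟩ : ∃ k, d = k + 1 := ⟨d - 1, by omega⟩
  rw [Nat.add_sub_cancel] at hhd
  have he : HyperbolicInterlacers.StableAt f e :=
    (HyperbolicInterlacers.stableAt_iff hfd).2 hfe.2
  tfae_have 1 → 4 :=
    HyperbolicInterlacers.wronskian_nonneg_of_mem_interlacerSet hfd hfpos hhd
  tfae_have 4 → 3 := by
    intro h4 x hx
    simpa [hx] using h4 x
  tfae_have 3 → 2 := by
    intro h3 a ha
    refine HyperbolicInterlacers.mem_interlacerSet_of_nonneg hfd hfsq
      (he.of_mem_hyperbolicityCone hfd (Nat.succ_ne_zero k) ha)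
      (HyperbolicInterlacers.eval_pos_of_mem_hyperbolicityCone hfpos ha) hhd hh0 fun x hx => ?_
    have := h3 x hx
    rw [map_mul] at this ⊢
    exact he.derivative_mul_nonneg hfd (Nat.succ_ne_zero k) ha hx this
  tfae_have 2 → 1 := fun h2 => h2 e (mem_connectedComponentIn hfpos.ne')
  tfae_finish
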